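/- Let $G$ be an infinite connected graph of bounded degree with vertex set $V$ and graph metric $\rho$. For $v\in V$ write $B(v,n)=\{x:\rho(v,x)\le n\}$, $S(v,n)=\{x:\rho(v,x)=n\}$ and $A(v,m,n)=B(v,n)\setminus B(v,m-1)$. Let $\mathbb P_p$ be Bernoulli bond percolation on $G$ with parameter $p\in[0,1]$, let $C(v)$ be the open cluster of $v$, and let $p_c=\inf\{p:\mathbb P_p[|C(v)|=\infty]>0\}$, which does not depend on $v$. For $X,Y,Z\subset V$ let "$X\leftrightarrow Y$ in $Z$" be the event that there is an open path from a vertex of $X$ to a vertex of $Y$ all of whose vertices are in $Z$; "in $Z$" is omitted when $Z=V$. Consider the following assumptions. (A1) For every $p\in[0,1]$ there is $\mathbb P_p$-almost surely at most one infinite open cluster. (A2) There are $v\in V$, $\delta>0$ and $c_*>0$ such that for every $p\in[p_c,p_c+\delta]\cap[0,1]$, every integer $m>0$, every finite connected set $Z\subset V$ with $Z\supseteq A(v,m,4m)$, and all $X\subset Z\cap B(v,m)$ and $Y\subset Z\setminus B(v,4m)$, $$\mathbb P_p[X\leftrightarrow Y\text{ in }Z]\ \ge\ c_*\,\mathbb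 P_p[X\leftrightarrow S(v,2m)\text{ in }Z]\,\mathbb P_p[Y\leftrightarrow S(v,2m)\text{ in }Z].$$ Theorem. (i) Assume (A1) and (A2). Then for every $w\in V$ and every cylinder event $E$ (an event that depends on the states of finitely many edges), the limits $$\lim_{n\to\infty}\mathbb P_{p_c}[E\mid w\leftrightarrow S(w,n)]\qquad\text{and}\qquad\lim_{p\searrow p_c}\mathbb P_p[E\mid |C(w)|=\infty]$$ exist and are equal (if $p_c=1$, the second limit is void and only the first is asserted). For each $w$, the common value is $\nu_{G,w}(E)$ for a probability measure $\nu_{G,w}$ on configurations of open and closed edges, Kesten's incipient infinite cluster measure. (ii) Assume only that there is $\mathbb P_{p_c}$-almost surely at most one infinite open cluster, and that there are $v\in V$ and $c_*>0$ such that the inequality of (A2) holds at $p=p_c$ for all $m,Z,X,Y$ as in (A2). Then for every $w\in V$ and every cylinder event $E$ the first limit exists. -/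

import Mathlib

namespace BondPercolation

/-- A bond configuration on `G`: `true` means that the edge is open. -/
abbrev Config {V : Type*} (G : SimpleGraph V) : Type _ := G.edgeSet → Bool

/-- The Bernoulli bond percolation measure with parameter `p`: each edge is open with probability
`p`, independently of the other edges. -/
noncomputable def perc {V : Type*} (G : SimpleGraph V) (p : unitInterval) :
    MeasureTheory.Measure (Config G) :=
  MeasureTheory.Measure.infinitePi
    (fun _ : G.edgeSet => ProbabilityTheory.bernoulliMeasure true false p)

/-- The probability of an event, as a real number. -/
noncomputable def prob {V : Type*} (G : SimpleGraph V) (p : unitInterval) (A : Set (Config G)) :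
    ℝ :=
  (perc G p).real A

/-- The conditional probability of `E` given `A`, as a real number. -/
noncomputable def condProb {V : Type*} (G : SimpleGraph V) (p : unitInterval)
    (E A : Set (Config G)) : ℝ :=
  (ProbabilityTheory.cond (perc G p) A).real E

/-- The subgraph formed by the open edges. -/
def openGraph {V : Type*} (G : SimpleGraph V) (ω : Config G) : SimpleGraph V where
  Adj x y := ∃ h : G.Adj x y, ω ⟨s(x, y), h⟩ = true
  symm := ⟨by
    rintro x y ⟨h, hω⟩
    refine ⟨h.symm, ?_⟩
    have e : (⟨s(y, x), h.symm⟩ : G.edgeSet) = ⟨s(x, y), h⟩ := Subtype.ext Sym2.eq_swap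
    rw [e]
    exact hω⟩
  loopless := ⟨fun x hx => G.irrefl hx.1⟩

/-- The open cluster `C(x)` of a vertex. -/
def cluster {V : Type*} (G : SimpleGraph V) (ω : Config G) (x : V) : Set V :=
  {y | (openGraph G ω).Reachable x y}

/-- The event that the open cluster of `x` is infinite. -/
def clusterInfinite {V : Type*} (G : SimpleGraph V) (x : V) : Set (Config G) :=
  {ω | (cluster G ω x).Infinite}

/-- The event `X ↔ Y in Z`: some open path from a vertex of `X` to a vertex of `Y` has all its
vertices in `Z`. -/
def connIn {V : Type*} (G : SimpleGraph V) (X Y Z : Set V) : Set (Config G) :=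
  {ω | ∃ x ∈ X, ∃ y ∈ Y, ∃ π : (openGraph G ω).Walk x y, ∀ z ∈ π.support, z ∈ Z}

/-- The event `X ↔ Y`. -/
def conn {V : Type*} (G : SimpleGraph V) (X Y : Set V) : Set (Config G) :=
  connIn G X Y Set.univ

/-- The ball `B(v, n)` in the graph metric. -/
def ball {V : Type*} (G : SimpleGraph V) (v : V) (n : ℕ) : Set V := {x | G.dist v x ≤ n}

/-- The sphere `S(v, n)` in the graph metric. -/
def sphere {V : Type*} (G : SimpleGraph V) (v : V) (n : ℕ) : Set V := {x | G.dist v x = n}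

/-- The annulus `A(v, m, n)`, for `m ≥ 1`. -/
def annulus {V : Type*} (G : SimpleGraph V) (v : V) (m n : ℕ) : Set V :=
  ball G v n \ ball G v (m - 1)

/-- The critical threshold. (On a connected graph, positivity of the probability of an infinite
cluster does not depend on the vertex.) -/
noncomputable def pc {V : Type*} (G : SimpleGraph V) : unitInterval :=
  sInf {p | ∃ v : V, 0 < prob G p (clusterInfinite G v)}

/-- The vertex degrees are finite and uniformly bounded. -/
def BoundedDegree {V : Type*} (G : SimpleGraph V) : Prop :=
  ∃ D : ℕ, ∀ x : V, (G.neighborSet x).encard ≤ (D : ℕ∞)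

/-- At parameter `p`, almost surely there is at most one infinite open cluster. -/
def UniqueInfiniteCluster {V : Type*} (G : SimpleGraph V) (p : unitInterval) : Prop :=
  ∀ᵐ ω ∂(perc G p), ∀ x y : V,
    (cluster G ω x).Infinite → (cluster G ω y).Infinite → cluster G ω x = cluster G ω y

/-- Quasi-multiplicativity of crossing probabilities around `v` at parameter `p`, with
constant `c`. -/
def QuasiMultiplicative {V : Type*} (G : SimpleGraph V) (v : V) (p : unitInterval) (c : ℝ) :
    Prop :=
  ∀ m : ℕ, 0 < m → ∀ Z : Set V, Z.Finite → (G.induce Z).Connected → annulus G v m (4 * m) ⊆ Z →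
    ∀ X Y : Set V, X ⊆ Z ∩ ball G v m → Y ⊆ Z \ ball G v (4 * m) →
      c * prob G p (connIn G X (sphere G v (2 * m)) Z)
          * prob G p (connIn G Y (sphere G v (2 * m)) Z)
        ≤ prob G p (connIn G X Y Z)

end BondPercolation

namespace BondPercolation

open MeasureTheory ProbabilityTheory

/-! If `C(w)` is infinite with positive probability at `p_c`, both limits are the conditional
probability given that event: the events `w ↔ S(w, n)` decrease to it, and its probability, alone or
intersected with `E`, is right-continuous in `p`.

Otherwise no cluster is infinite at `p_c`, and the point is a loss of memory: given that `w` is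
joined in a finite region `Z` to a remote set `Y`, the probability of `E` hardly depends on `Z` and
`Y`. Suppose that these ratios lie in `[lo, hi]` at scale `N`, and take radii `N < L < K < M`.
Unless two distinct clusters cross an annulus, the connection runs through one crossing cluster `d`
between `N` and `K`, and the probability splits into a factor for `d`, an inner factor and an outer
factor (`prob_inter_throughCluster`). By quasi-multiplicativity the outer factor is, up to the
constant `c`, a function of the cluster times a function of `(Y, Z)`. Averaging against a kernel so
close to rank one shrinks `hi - lo` by the factor `1 - c`, up to a small error
(`weighted_ratio_bounds`, `exists_ratioBounds_step`).

Two facts make this step possible. Two distinct crossings cost at most a constant times the square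
of the one-arm probability, which is negligible against the one-arm probability when nothing
percolates (`eventually_prob_twoCrossings_lt`). And quasi-multiplicativity is given for connected
regions only, while removing `d` may disconnect; but without percolation it forces the graph to have
one end (`oneEndedAt`), so a remote annulus stays in one component of what is left
(`exists_holeMultiplicative`).

The scales are fixed at `p_c` by events of finitely many edges, whose probabilities are continuous
in `p`. Hence the Cauchy property in `n` is uniform for `p` near `p_c`, and the limits in `n` and
`p` can be interchanged. Compactness turns the limits into a measure. -/

instance isProbabilityMeasure_perc {V : Type*} (G : SimpleGraph V) (p : unitInterval) :
    IsProbabilityMeasure (perc G p) := by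
  unfold perc; infer_instance

/-- The event `A` is determined by the states of the edges in `S`. -/
def DepOn {V : Type*} {G : SimpleGraph V} (A : Set (Config G)) (S : Set G.edgeSet) : Prop :=
  ∀ ω ω' : Config G, (∀ e ∈ S, ω e = ω' e) → ω ∈ A → ω' ∈ A

/-! ### Events determined by finitely many edges -/

section Basic

variable {V : Type*} {G : SimpleGraph V} {A B : Set (Config G)} {S T : Set G.edgeSet}
  {p q : unitInterval}

lemma DepOn.mono (h : DepOn A S) (hST : S ⊆ T) : DepOn A T :=
  fun ω ω' hω => h ω ω' fun e he => hω e (hST he)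

lemma DepOn.inter (hA : DepOn A S) (hB : DepOn B T) : DepOn (A ∩ B) (S ∪ T) :=
  fun ω ω' hω h => ⟨hA ω ω' (fun e he => hω e (Or.inl he)) h.1,
    hB ω ω' (fun e he => hω e (Or.inr he)) h.2⟩

lemma DepOn.inter_same (hA : DepOn A S) (hB : DepOn B S) : DepOn (A ∩ B) S := by
  simpa using hA.inter hB

lemma DepOn.eq_preimage (hA : DepOn A S) (hS : S.Finite) :
    A = hS.toFinset.restrict ⁻¹' (hS.toFinset.restrict '' A) := by
  ext ω
  refine ⟨fun h => ⟨ω, h, rfl⟩, ?_⟩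
  rintro ⟨ω', h, he⟩
  refine hA ω' ω (fun e h' => ?_) h
  exact congrFun he ⟨e, by simpa using h'⟩

lemma DepOn.measurableSet (hA : DepOn A S) (hS : S.Finite) : MeasurableSet A := by
  rw [hA.eq_preimage hS]
  exact measurableSet_preimage (Finset.measurable_restrict _) (Set.toFinite _).measurableSet

lemma DepOn.prob_inter (hA : DepOn A S) (hB : DepOn B T) (hS : S.Finite) (hT : T.Finite)
    (hd : Disjoint S T) : prob G p (A ∩ B) = prob G p A * prob G p B := by
  have h0 : iIndepFun (fun (e : G.edgeSet) (ω : Config G) => ω e) (perc G p) :=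
    iIndepFun_infinitePi (P := fun _ : G.edgeSet => bernoulliMeasure true false p)
      (X := fun _ b => b) (fun _ => measurable_id)
  have hd' : Disjoint hS.toFinset hT.toFinset := by
    rw [Finset.disjoint_left]
    intro e he he'
    exact Set.disjoint_left.1 hd (by simpa using he) (by simpa using he')
  have h1 := h0.indepFun_finset hS.toFinset hT.toFinset hd' (fun _ => measurable_pi_apply _)
  have h2 := h1.measure_inter_preimage_eq_mul (hS.toFinset.restrict '' A)
    (hT.toFinset.restrict '' B) (Set.toFinite _).measurableSet (Set.toFinite _).measurableSet
  have eA := hA.eq_preimage hS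
  have eB := hB.eq_preimage hT
  have h3 : perc G p (A ∩ B) = perc G p A * perc G p B := by
    rw [eA, eB]; exact h2
  simp only [prob, measureReal_def, h3, ENNReal.toReal_mul]

lemma prob_nonneg : 0 ≤ prob G p A := measureReal_nonneg

lemma prob_le_one : prob G p A ≤ 1 := measureReal_le_one

lemma prob_mono (h : A ⊆ B) : prob G p A ≤ prob G p B := measureReal_mono h

lemma prob_union_le : prob G p (A ∪ B) ≤ prob G p A + prob G p B := measureReal_union_le _ _

lemma prob_iUnion_le {ι : Type*} (I : Finset ι) (f : ι → Set (Config G)) :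
    prob G p {ω | ∃ i ∈ I, ω ∈ f i} ≤ ∑ i ∈ I, prob G p (f i) := by
  have : {ω | ∃ i ∈ I, ω ∈ f i} = ⋃ i ∈ I, f i := by ext; simp
  rw [this]
  exact measureReal_biUnion_finset_le I f

lemma sum_prob_le {ι : Type*} (I : Finset ι) (f : ι → Set (Config G))
    (hm : ∀ i ∈ I, MeasurableSet (f i)) (hsub : ∀ i ∈ I, f i ⊆ A)
    (hd : ∀ i ∈ I, ∀ j ∈ I, i ≠ j → Disjoint (f i) (f j)) :
    ∑ i ∈ I, prob G p (f i) ≤ prob G p A := by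
  have : ∑ i ∈ I, prob G p (f i) = prob G p (⋃ i ∈ I, f i) := by
    refine (measureReal_biUnion_finset ?_ hm).symm
    intro i hi j hj hij
    exact hd i hi j hj hij
  rw [this]
  exact prob_mono (Set.iUnion₂_subset hsub)

lemma prob_eq_mul_prod (F : Finset G.edgeSet) (η : G.edgeSet → Bool) :
    prob G p {ω | ∀ e ∈ F, ω e = η e} = ∏ e ∈ F, if η e = true then (p : ℝ) else 1 - p := by
  have h1 : {ω : Config G | ∀ e ∈ F, ω e = η e} = (↑F : Set G.edgeSet).pi (fun e => {η e}) := by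
    ext ω; simp [Set.mem_pi]
  have h2 := Measure.infinitePi_pi (fun _ : G.edgeSet => bernoulliMeasure true false p)
    (s := F) (t := fun e => {η e}) (fun _ _ => measurableSet_singleton _)
  rw [prob, measureReal_def, h1, perc, h2, ENNReal.toReal_prod]
  refine Finset.prod_congr rfl fun e _ => ?_
  rw [← measureReal_def, bernoulliMeasure_real_apply _ (measurableSet_singleton _)]
  cases h : η e <;> simp

lemma prob_all_open (F : Finset G.edgeSet) :
    prob G p {ω | ∀ e ∈ F, ω e = true} = (p : ℝ) ^ F.card := by
  simpa using prob_eq_mul_prod (p := p) F (fun _ => true)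

/-- Summing over the finitely many patterns on `S` gives a polynomial in `p`. This is what carries
strict inequalities from `p_c` to nearby parameters. -/
lemma DepOn.continuous_prob (hA : DepOn A S) (hS : S.Finite) :
    Continuous fun p : unitInterval => prob G p A := by
  classical
  set F := hS.toFinset with hF
  let ext' : (F → Bool) → G.edgeSet → Bool := fun σ e => if h : e ∈ F then σ ⟨e, h⟩ else true
  let I : Finset (F → Bool) := (Set.toFinite (F.restrict '' A)).toFinset
  have key : ∀ p : unitInterval, prob G p A
      = ∑ σ ∈ I, ∏ e ∈ F, if ext' σ e = true then (p : ℝ) else 1 - p := by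
    intro p
    have h1 : A = ⋃ σ ∈ I, {ω : Config G | ∀ e ∈ F, ω e = ext' σ e} := by
      ext ω
      simp only [Set.mem_iUnion, Set.mem_ofPred_eq, exists_prop]
      constructor
      · intro h
        refine ⟨F.restrict ω, by simpa [I] using ⟨ω, h, rfl⟩, fun e he => ?_⟩
        simp [ext', he]
      · rintro ⟨σ, hσ, h⟩
        obtain ⟨ω', hω', rfl⟩ : σ ∈ F.restrict '' A := by simpa [I] using hσ
        refine hA ω' ω (fun e he => ?_) hω'
        have he' : e ∈ F := by simpa [hF] using he
        rw [h e he']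
        simp [ext', he']
    conv_lhs => rw [h1]
    rw [prob, measureReal_biUnion_finset]
    · exact Finset.sum_congr rfl fun σ _ => prob_eq_mul_prod F _
    · intro σ _ τ _ hne
      refine Set.disjoint_left.2 fun ω h h' => hne ?_
      ext ⟨e, he⟩
      have := (h e he).symm.trans (h' e he)
      simpa [ext', he] using this
    · intro σ _
      refine DepOn.measurableSet (S := (F : Set G.edgeSet)) ?_ F.finite_toSet
      intro ω ω' h hω e he
      rw [← h e he, hω e he]
  simp_rw [key]
  refine continuous_finsetSum _ fun σ _ => continuous_finsetProd _ fun e _ => ?_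
  split_ifs <;> fun_prop

/-- The configuration obtained by opening the edges in `F`. -/
def openEdges [DecidableEq V] (F : Finset G.edgeSet) (ω : Config G) : Config G :=
  fun e => if e ∈ F then true else ω e

/-- Finite energy: "`F` is open" is independent of "opening `F` produces `B`", and together they
imply `B`. -/
lemma pow_card_mul_prob_le [DecidableEq V] (F : Finset G.edgeSet) (hB : DepOn B T) (hT : T.Finite)
    (h : ∀ ω ∈ A, openEdges F ω ∈ B) :
    (p : ℝ) ^ F.card * prob G p A ≤ prob G p B := by
  have hA' : DepOn {ω | openEdges F ω ∈ B} (T \ F) := by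
    intro ω ω' hω h
    refine hB _ _ (fun e he => ?_) h
    by_cases heF : e ∈ F
    · simp [openEdges, heF]
    · simpa [openEdges, heF] using hω e ⟨he, by simpa using heF⟩
  have hO : DepOn {ω : Config G | ∀ e ∈ F, ω e = true} (F : Set G.edgeSet) := by
    intro ω ω' h hω e he
    rw [← h e he, hω e he]
  calc (p : ℝ) ^ F.card * prob G p A
      ≤ (p : ℝ) ^ F.card * prob G p {ω | openEdges F ω ∈ B} := by
        have := p.2.1
        gcongr
        exact prob_mono h
    _ = prob G p ({ω : Config G | ∀ e ∈ F, ω e = true} ∩ {ω | openEdges F ω ∈ B}) := by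
        rw [hO.prob_inter hA' F.finite_toSet (hT.subset Set.sdiff_subset) Set.disjoint_sdiff_right,
          prob_all_open]
    _ ≤ prob G p B := by
        refine prob_mono fun ω hω => ?_
        have : openEdges F ω = ω := by
          funext e
          by_cases he : e ∈ F
          · simp [openEdges, he, hω.1 e he]
          · simp [openEdges, he]
        have h2 := hω.2
        rwa [Set.mem_ofPred_eq, this] at h2

/-- The standard coupling: one family of uniform labels serves all `p` at once, which makes
increasing events monotone in `p`. -/
lemma perc_eq_map (p : unitInterval) :
    perc G p = (Measure.infinitePi fun _ : G.edgeSet => (volume : Measure unitInterval)).map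
      (fun u e => decide (u e ≤ p)) := by
  have hm : Measurable fun u : unitInterval => decide (u ≤ p) :=
    measurable_to_bool (by
      have : (fun u : unitInterval => decide (u ≤ p)) ⁻¹' {true} = Set.Iic p := by ext; simp
      rw [this]; exact measurableSet_Iic)
  rw [Measure.infinitePi_map_pi (fun _ : G.edgeSet => (volume : Measure unitInterval))
    (fun _ => hm), perc]
  congr 1
  funext _
  refine Measure.ext fun s hs => ?_
  classical
  rw [Measure.map_apply hm hs, bernoulliMeasure_apply p hs]
  have e1 : ∀ h : unitInterval, ENNReal.ofReal (h : ℝ) = (unitInterval.toNNReal h : ENNReal) := by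
    intro h
    rw [ENNReal.ofReal]; congr 1
    exact Real.toNNReal_of_nonneg h.2.1
  by_cases ht : true ∈ s <;> by_cases hf : false ∈ s
  · have : (fun u : unitInterval => decide (u ≤ p)) ⁻¹' s = Set.univ := by
      ext u; by_cases hu : u ≤ p <;> simp [hu, ht, hf]
    simp [this, ht, hf]
  · have : (fun u : unitInterval => decide (u ≤ p)) ⁻¹' s = Set.Iic p := by
      ext u; by_cases hu : u ≤ p <;> simp [hu, ht, hf]
    rw [this]
    simp [ht, hf, e1]
  · have : (fun u : unitInterval => decide (u ≤ p)) ⁻¹' s = Set.Ioi p := by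
      ext u; by_cases hu : u ≤ p <;> simp [hu, ht, hf, not_le.1]
    rw [this]
    have := e1 (unitInterval.symm p)
    simp [ht, hf, ← this]
  · have : (fun u : unitInterval => decide (u ≤ p)) ⁻¹' s = ∅ := by
      ext u; by_cases hu : u ≤ p <;> simp [hu, ht, hf]
    simp [this, ht, hf]

lemma prob_mono_param (hA : MeasurableSet A)
    (hinc : ∀ ω ω' : Config G, (∀ e, ω e = true → ω' e = true) → ω ∈ A → ω' ∈ A)
    (hpq : p ≤ q) : prob G p A ≤ prob G q A := by
  have hm : ∀ r : unitInterval, Measurable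
      (fun (u : G.edgeSet → unitInterval) (e : G.edgeSet) => decide (u e ≤ r)) := by
    intro r
    refine measurable_pi_lambda _ fun e => measurable_to_bool ?_
    have : (fun u : G.edgeSet → unitInterval => decide (u e ≤ r)) ⁻¹' {true}
        = (fun u => u e) ⁻¹' Set.Iic r := by ext; simp
    rw [this]
    exact measurableSet_preimage (measurable_pi_apply e) measurableSet_Iic
  rw [prob, prob, perc_eq_map, perc_eq_map, map_measureReal_apply (hm p) hA,
    map_measureReal_apply (hm q) hA]
  refine measureReal_mono fun u hu => hinc _ _ (fun e he => ?_) hu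
  simp only [decide_eq_true_eq] at he ⊢
  exact he.trans hpq

end Basic

/-! ### Walks confined to a vertex set -/

/-- `x` and `y` are joined by a walk of `H` all of whose vertices are in `Z`. -/
def Joined {V : Type*} (H : SimpleGraph V) (Z : Set V) (x y : V) : Prop :=
  ∃ π : H.Walk x y, ∀ z ∈ π.support, z ∈ Z

section Joined

variable {V : Type*} {H H' : SimpleGraph V} {Z Z' T : Set V} {x y z : V}

lemma Joined.refl (hx : x ∈ Z) : Joined H Z x x := ⟨.nil, by simpa using hx⟩

lemma Joined.symm (h : Joined H Z x y) : Joined H Z y x := by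
  obtain ⟨π, hπ⟩ := h
  exact ⟨π.reverse, by simpa using hπ⟩

lemma Joined.trans (h : Joined H Z x y) (h' : Joined H Z y z) : Joined H Z x z := by
  obtain ⟨π, hπ⟩ := h
  obtain ⟨π', hπ'⟩ := h'
  refine ⟨π.append π', fun u hu => ?_⟩
  rw [SimpleGraph.Walk.mem_support_append_iff] at hu
  exact hu.elim (hπ u) (hπ' u)

lemma Joined.mono (h : Joined H Z x y) (hZ : Z ⊆ Z') : Joined H Z' x y := by
  obtain ⟨π, hπ⟩ := h
  exact ⟨π, fun u hu => hZ (hπ u hu)⟩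

lemma Joined.left_mem (h : Joined H Z x y) : x ∈ Z := by
  obtain ⟨π, hπ⟩ := h
  exact hπ x π.start_mem_support

lemma Joined.right_mem (h : Joined H Z x y) : y ∈ Z := h.symm.left_mem

lemma Joined.of_adj (h : H.Adj x y) (hx : x ∈ Z) (hy : y ∈ Z) : Joined H Z x y :=
  ⟨.cons h .nil, by simp [hx, hy]⟩

lemma Joined.cons (h : H.Adj x y) (hx : x ∈ Z) (h' : Joined H Z y z) : Joined H Z x z :=
  (Joined.of_adj h hx h'.left_mem).trans h'

lemma Joined.concat (h' : Joined H Z x y) (h : H.Adj y z) (hz : z ∈ Z) : Joined H Z x z :=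
  h'.trans (Joined.of_adj h h'.right_mem hz)

@[elab_as_elim]
lemma Joined.induction_left {P : V → Prop} (h : Joined H Z x y) (hy : P y)
    (hs : ∀ a b, H.Adj a b → a ∈ Z → Joined H Z b y → P b → P a) : P x := by
  obtain ⟨π, hπ⟩ := h
  induction π with
  | nil => exact hy
  | cons hadj π ih =>
    have h1 : ∀ z ∈ π.support, z ∈ Z := fun z hz => hπ z (by simp [hz])
    exact hs _ _ hadj (hπ _ (by simp)) ⟨π, h1⟩ (ih hy hs h1)

lemma Joined.imp_graph (h : Joined H Z x y)
    (hadj : ∀ a ∈ Z, ∀ b ∈ Z, H.Adj a b → H'.Adj a b) : Joined H' Z x y :=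
  h.induction_left (P := fun x => Joined H' Z x y) (Joined.refl h.right_mem)
    fun a b hab ha hb h' => Joined.cons (hadj a ha b hb.left_mem hab) ha h'

/-- A walk that starts in a set which it cannot leave stays there. -/
lemma Joined.inter_of_closed (h : Joined H Z x y) (hx : x ∈ T)
    (hT : ∀ a ∈ Z ∩ T, ∀ b ∈ Z, H.Adj a b → b ∈ T) : Joined H (Z ∩ T) x y := by
  refine h.induction_left (P := fun x => x ∈ T → Joined H (Z ∩ T) x y)
    (fun hy => Joined.refl ⟨h.right_mem, hy⟩) (fun a b hab ha hb ih haT => ?_) hx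
  exact Joined.cons hab ⟨ha, haT⟩ (ih (hT a ⟨ha, haT⟩ b hb.left_mem hab))

/-- Decomposition of a walk at its first vertex in `T`. -/
lemma Joined.first_hit (h : Joined H Z x y) (hx : x ∉ T) (hy : y ∈ T) :
    ∃ u t, Joined H (Z \ T) x u ∧ H.Adj u t ∧ t ∈ T ∧ Joined H Z t y := by
  refine h.induction_left (P := fun x => x ∉ T →
    ∃ u t, Joined H (Z \ T) x u ∧ H.Adj u t ∧ t ∈ T ∧ Joined H Z t y)
    (fun h => absurd hy h) (fun a b hab ha hb ih haT => ?_) hx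
  by_cases hbT : b ∈ T
  · exact ⟨a, b, Joined.refl ⟨ha, haT⟩, hab, hbT, hb⟩
  · obtain ⟨u, t, h1, h2, h3, h4⟩ := ih hbT
    exact ⟨u, t, Joined.cons hab ⟨ha, haT⟩ h1, h2, h3, h4⟩

/-- Decomposition of a walk at its last vertex in `T`. -/
lemma Joined.last_exit (h : Joined H Z x y) (hx : x ∈ T) (hy : y ∉ T) :
    ∃ t u, Joined H Z x t ∧ t ∈ T ∧ H.Adj t u ∧ Joined H (Z \ T) u y := by
  obtain ⟨u, t, h1, h2, h3, h4⟩ := h.symm.first_hit hy hx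
  exact ⟨t, u, h4.symm, h3, h2.symm, h1.symm⟩

end Joined

/-! ### Balls and spheres in the graph metric -/

section Geometry

variable {V : Type*} {G : SimpleGraph V} {v x y : V} {m n : ℕ}

lemma mem_ball_iff : x ∈ ball G v n ↔ G.dist v x ≤ n := Iff.rfl

lemma mem_sphere_iff : x ∈ sphere G v n ↔ G.dist v x = n := Iff.rfl

lemma ball_mono (h : m ≤ n) : ball G v m ⊆ ball G v n := fun _ hx => le_trans hx h

lemma sphere_subset_ball (h : m ≤ n) : sphere G v m ⊆ ball G v n :=
  fun _ hx => le_trans (le_of_eq hx) h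

lemma self_mem_ball : v ∈ ball G v n := by simp [ball]

lemma dist_le_succ (hconn : G.Connected) (h : G.Adj x y) : G.dist v y ≤ G.dist v x + 1 :=
  (hconn.dist_triangle (v := x)).trans (by rw [SimpleGraph.dist_eq_one_iff_adj.2 h])

lemma ball_finite (hconn : G.Connected) (hdeg : BoundedDegree G) (v : V) (n : ℕ) :
    (ball G v n).Finite := by
  obtain ⟨D, hD⟩ := hdeg
  have hfin : ∀ x, (G.neighborSet x).Finite := fun x =>
    Set.encard_ne_top_iff.1 (ne_top_of_le_ne_top (ENat.natCast_ne_top D) (hD x))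
  induction n with
  | zero =>
    refine (Set.finite_singleton v).subset fun x hx => ?_
    have : G.dist v x = 0 := Nat.le_zero.1 hx
    exact ((hconn.dist_eq_zero_iff).1 this).symm
  | succ n ih =>
    refine (ih.union (ih.biUnion fun x _ => hfin x)).subset fun x hx => ?_
    by_cases h : x ∈ ball G v n
    · exact Or.inl h
    right
    obtain ⟨π, hπ⟩ := hconn.exists_walk_length_eq_dist x v
    cases π with
    | nil => exact absurd self_mem_ball h
    | @cons _ b _ hab π =>
      simp only [Set.mem_iUnion]
      refine ⟨b, ?_, hab.symm⟩
      have h1 : G.dist b v ≤ π.length := SimpleGraph.dist_le π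
      have h2 : G.dist v x ≤ n + 1 := hx
      rw [SimpleGraph.dist_comm] at h2
      rw [SimpleGraph.Walk.length_cons] at hπ
      rw [mem_ball_iff, SimpleGraph.dist_comm]
      omega

lemma joined_ball (hconn : G.Connected) (v x : V) : Joined G (ball G v (G.dist v x)) v x := by
  obtain ⟨π, hπ⟩ := hconn.exists_walk_length_eq_dist v x
  refine ⟨π, fun z hz => ?_⟩
  classical
  rw [mem_ball_iff, ← hπ]
  exact (SimpleGraph.dist_le (π.takeUntil z hz)).trans (π.length_takeUntil_le_length hz)

lemma exists_joined_sphere (hconn : G.Connected) {k : ℕ} (h : k < G.dist v x) :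
    ∃ s ∈ sphere G v (k + 1), Joined G (ball G v (G.dist v x) \ ball G v k) s x := by
  obtain ⟨t, u, -, h2, h3, h4⟩ := (joined_ball hconn v x).last_exit (T := ball G v k)
    self_mem_ball (by simpa [mem_ball_iff] using h)
  refine ⟨u, ?_, h4⟩
  have h5 : ¬ G.dist v u ≤ k := h4.left_mem.2
  have h6 : G.dist v t ≤ k := h2
  have := dist_le_succ (v := v) hconn h3
  rw [mem_sphere_iff]; omega

/-- Along a walk the distance to `v` takes all intermediate values. -/
lemma Joined.exists_sphere {H : SimpleGraph V} (hH : H ≤ G) (hconn : G.Connected) {Z : Set V}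
    (h : Joined H Z x y) (hx : G.dist v x ≤ n) (hy : n ≤ G.dist v y) :
    ∃ t ∈ sphere G v n, Joined H (Z ∩ ball G v n) x t ∧ Joined H Z t y := by
  rcases hy.eq_or_lt with hy | hy
  · by_cases hxn : G.dist v x = n
    · exact ⟨x, hxn, Joined.refl ⟨h.left_mem, hx⟩, h⟩
    obtain ⟨u, t, h1, h2, h3, h4⟩ := h.first_hit (T := {z | n ≤ G.dist v z})
      (by simp; omega) (by simp [hy])
    have h5 : ¬ n ≤ G.dist v u := h1.right_mem.2
    have h6 : n ≤ G.dist v t := h3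
    have := dist_le_succ (v := v) hconn (hH h2)
    have h7 : G.dist v t = n := by omega
    refine ⟨t, h7, ?_, h4⟩
    refine (h1.mono (Z' := Z ∩ ball G v n) fun z hz => ⟨hz.1, ?_⟩).concat h2 ⟨h4.left_mem, h7.le⟩
    have : ¬ n ≤ G.dist v z := hz.2
    rw [mem_ball_iff]; omega
  · obtain ⟨u, t, h1, h2, h3, h4⟩ := h.first_hit (T := (ball G v n)ᶜ)
      (by simpa [mem_ball_iff] using hx) (by simpa [mem_ball_iff] using hy)
    rw [sdiff_compl] at h1
    have h5 : G.dist v u ≤ n := h1.right_mem.2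
    have h6 : ¬ G.dist v t ≤ n := h3
    have := dist_le_succ (v := v) hconn (hH h2)
    exact ⟨u, by rw [mem_sphere_iff]; omega, h1, Joined.cons h2 h1.right_mem.1 h4⟩

end Geometry

/-! ### Clusters, and independence of connections in separate regions -/

/-- The edges with both endpoints in `Z`. -/
def edgesIn {V : Type*} (G : SimpleGraph V) (Z : Set V) : Set G.edgeSet :=
  {e | ∀ a ∈ e.1, a ∈ Z}

/-- The edges with an endpoint in `d`. -/
def edgesAt {V : Type*} (G : SimpleGraph V) (d : Set V) : Set G.edgeSet :=
  {e | ∃ a ∈ e.1, a ∈ d}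

/-- `d` is empty or an open cluster of the subgraph induced by `A`. -/
def isCluster {V : Type*} (G : SimpleGraph V) (A d : Set V) : Set (Config G) :=
  {ω | ∀ a ∈ d, ∀ b, Joined (openGraph G ω) A a b ↔ b ∈ d}

section Edges

variable {V : Type*} {G : SimpleGraph V} {v x y : V} {X Y Z Z' A d T : Set V} {n r : ℕ}
  {p : unitInterval} {ω ω' : Config G}

lemma openGraph_le (ω : Config G) : openGraph G ω ≤ G := fun _ _ h => h.1

lemma openGraph_adj_congr (h : ∀ e : G.edgeSet, e.1 = s(x, y) → ω e = ω' e)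
    (hxy : (openGraph G ω).Adj x y) : (openGraph G ω').Adj x y := by
  obtain ⟨h1, h2⟩ := hxy
  exact ⟨h1, by rw [← h _ rfl]; exact h2⟩

lemma edgesIn_mono (h : Z ⊆ Z') : edgesIn G Z ⊆ edgesIn G Z' := fun _ he a ha => h (he a ha)

lemma edgesIn_finite (h : Z.Finite) : (edgesIn G Z).Finite := by
  refine Set.Finite.of_finite_image (f := Subtype.val) ?_ Subtype.val_injective.injOn
  refine ((h.prod h).image fun q : V × V => s(q.1, q.2)).subset ?_
  rintro _ ⟨⟨e, he⟩, hZ, rfl⟩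
  induction e with
  | _ a b => exact ⟨(a, b), ⟨hZ a (by simp), hZ b (by simp)⟩, rfl⟩

lemma edgesAt_subset (hconn : G.Connected) (h : d ⊆ ball G v n) :
    edgesAt G d ⊆ edgesIn G (ball G v (n + 1)) := by
  rintro ⟨e, he⟩ ⟨a, ha, had⟩ b hb
  by_cases hab : b = a
  · subst hab; exact ball_mono (Nat.le_succ n) (h had)
  have h1 : e = s(a, b) := ((Sym2.mem_and_mem_iff (Ne.symm hab)).1 ⟨ha, hb⟩)
  subst h1
  have h2 : G.dist v a ≤ n := h had
  have := dist_le_succ (v := v) hconn (show G.Adj a b from he)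
  rw [mem_ball_iff]; omega

lemma disjoint_edgesAt_edgesIn (h : Disjoint d Z) : Disjoint (edgesAt G d) (edgesIn G Z) :=
  Set.disjoint_left.2 fun _ ⟨a, ha, had⟩ he => Set.disjoint_left.1 h had (he a ha)

lemma disjoint_edgesIn (h : Disjoint Z Z') : Disjoint (edgesIn G Z) (edgesIn G Z') := by
  refine Set.disjoint_left.2 ?_
  rintro ⟨e, he⟩ h1 h2
  induction e with
  | _ a b => exact Set.disjoint_left.1 h (h1 a (by simp)) (h2 a (by simp))

lemma joined_congr (hω : ∀ e ∈ edgesIn G Z, ω e = ω' e) (h : Joined (openGraph G ω) Z x y) :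
    Joined (openGraph G ω') Z x y := by
  refine h.imp_graph fun a ha b hb hab => openGraph_adj_congr (fun e he => hω e ?_) hab
  intro c hc
  rw [he, Sym2.mem_iff] at hc
  rcases hc with rfl | rfl <;> assumption

lemma mem_connIn : ω ∈ connIn G X Y Z ↔ ∃ x ∈ X, ∃ y ∈ Y, Joined (openGraph G ω) Z x y := Iff.rfl

lemma depOn_connIn : DepOn (connIn G X Y Z) (edgesIn G Z) := by
  rintro ω ω' hω ⟨x, hx, y, hy, h⟩
  exact ⟨x, hx, y, hy, joined_congr hω h⟩

lemma connIn_mono (hX : X ⊆ A) (hY : Y ⊆ d) (hZ : Z ⊆ Z') : connIn G X Y Z ⊆ connIn G A d Z' := by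
  rintro ω ⟨x, hx, y, hy, h⟩
  exact ⟨x, hX hx, y, hY hy, Joined.mono h hZ⟩

lemma measurableSet_connIn (hZ : Z.Finite) : MeasurableSet (connIn G X Y Z) :=
  depOn_connIn.measurableSet (edgesIn_finite hZ)

/-- Exploring a cluster reads only the edges that touch it: a walk from `d` inside `A` cannot leave
`d` without using such an edge. The edges off `d` therefore remain independent of the event. -/
lemma depOn_isCluster : DepOn (isCluster G A d) (edgesAt G d) := by
  intro ω ω' hω h a ha b
  have hadj : ∀ a ∈ d, ∀ b, ((openGraph G ω).Adj a b ↔ (openGraph G ω').Adj a b) := by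
    intro a ha b
    have : ∀ e : G.edgeSet, e.1 = s(a, b) → ω e = ω' e :=
      fun e he => hω e ⟨a, by simp [he], ha⟩
    exact ⟨openGraph_adj_congr this, openGraph_adj_congr fun e he => (this e he).symm⟩
  constructor
  · intro h'
    exact (h'.inter_of_closed ha fun a ha b hb hab =>
      (h a ha.2 b).1 (Joined.of_adj ((hadj a ha.2 b).2 hab) ha.1 hb)).right_mem.2
  · intro hb
    refine Joined.mono (Z := A ∩ d) ?_ Set.inter_subset_left
    refine (((h a ha b).2 hb).inter_of_closed ha fun a ha b hb hab =>
      (h a ha.2 b).1 (Joined.of_adj hab ha.1 hb)).imp_graph ?_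
    exact fun a ha b _ hab => (hadj a ha.2 b).1 hab

lemma isCluster_setOf_joined (A : Set V) (a : V) :
    ω ∈ isCluster G A {b | Joined (openGraph G ω) A a b} :=
  fun _ hb _ => ⟨fun h => hb.trans h, fun h => hb.symm.trans h⟩

lemma eq_of_mem_isCluster {d' : Set V} (h : ω ∈ isCluster G A d) (h' : ω ∈ isCluster G A d')
    {a b : V} (ha : a ∈ d) (hb : b ∈ d') (hab : Joined (openGraph G ω) A a b) : d = d' := by
  ext c
  rw [← h a ha, ← h' b hb]
  exact ⟨fun h => hab.symm.trans h, fun h => hab.trans h⟩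

/-- A connection from inside `B(v, r)` to its outside factorizes at `S(v, r)`. -/
lemma prob_inter_connIn_le (hconn : G.Connected) (hdeg : BoundedDegree G) {E : Set (Config G)}
    (hE : DepOn E (edgesIn G (ball G v r))) (hX : X ⊆ ball G v r)
    (hY : ∀ y ∈ Y, r < G.dist v y) (hZ : Z.Finite) :
    prob G p (E ∩ connIn G X Y Z) ≤
      prob G p (E ∩ connIn G X (sphere G v r) (Z ∩ ball G v r)) *
        prob G p (connIn G Y (sphere G v r) Z) := by
  -- The path from `Y` is stopped on entering the ball. Even its last edge has an endpoint outside,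
  -- so `J` is independent of everything inside the ball.
  set J : Set (Config G) := {ω | ∃ y ∈ Y, ∃ u, Joined (openGraph G ω) (Z \ ball G v r) y u ∧
    ∃ t ∈ sphere G v r ∩ Z, (openGraph G ω).Adj u t} with hJ
  have hJdep : DepOn J (edgesIn G Z \ edgesIn G (ball G v r)) := by
    rintro ω ω' hω ⟨y, hy, u, h1, t, ht, h2⟩
    refine ⟨y, hy, u, joined_congr (fun e he => hω e ⟨edgesIn_mono Set.sdiff_subset he, ?_⟩) h1,
      t, ht, openGraph_adj_congr (fun e he => hω e ⟨?_, ?_⟩) h2⟩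
    · rcases e with ⟨e, he'⟩
      induction e with
      | _ a b => exact fun h => (he a (by simp)).2 (h a (by simp))
    · intro c hc
      rw [he, Sym2.mem_iff] at hc
      rcases hc with rfl | rfl
      · exact h1.right_mem.1
      · exact ht.2
    · exact fun h => h1.right_mem.2 (h u (by simp [he]))
  have hJsub : J ⊆ connIn G Y (sphere G v r) Z := by
    rintro ω ⟨y, hy, u, h1, t, ht, h2⟩
    exact ⟨y, hy, t, ht.1, (h1.mono Set.sdiff_subset).concat h2 ht.2⟩
  have hsub : E ∩ connIn G X Y Z ⊆
      (E ∩ connIn G X (sphere G v r) (Z ∩ ball G v r)) ∩ J := by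
    rintro ω ⟨hωE, x, hx, y, hy, h⟩
    have h : Joined (openGraph G ω) Z x y := h
    obtain ⟨t, ht, h1, -⟩ := h.exists_sphere (openGraph_le ω) hconn (hX hx) (hY y hy).le
    refine ⟨⟨hωE, x, hx, t, ht, h1⟩, y, hy, ?_⟩
    obtain ⟨u, t, h1, h2, h3, h4⟩ := h.symm.first_hit (T := ball G v r)
      (by simpa [mem_ball_iff] using hY y hy) (hX hx)
    refine ⟨u, h1, t, ⟨?_, h4.left_mem⟩, h2⟩
    have h5 : ¬ G.dist v u ≤ r := h1.right_mem.2
    have h6 : G.dist v t ≤ r := h3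
    have := dist_le_succ (v := v) hconn (openGraph_le ω h2.symm)
    rw [mem_sphere_iff]; omega
  have hfin : (ball G v r).Finite := ball_finite hconn hdeg v r
  calc prob G p (E ∩ connIn G X Y Z) ≤ _ := prob_mono hsub
    _ = prob G p (E ∩ connIn G X (sphere G v r) (Z ∩ ball G v r)) * prob G p J :=
        (hE.inter_same (depOn_connIn.mono (edgesIn_mono Set.inter_subset_right))).prob_inter hJdep
          (edgesIn_finite hfin) ((edgesIn_finite hZ).subset Set.sdiff_subset)
          Set.disjoint_sdiff_right
    _ ≤ _ := mul_le_mul_of_nonneg_left (prob_mono hJsub) prob_nonneg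

lemma prob_connIn_le (hconn : G.Connected) (hdeg : BoundedDegree G) (hX : X ⊆ ball G v r)
    (hY : ∀ y ∈ Y, r < G.dist v y) (hZ : Z.Finite) :
    prob G p (connIn G X Y Z) ≤ prob G p (connIn G X (sphere G v r) (Z ∩ ball G v r)) *
        prob G p (connIn G Y (sphere G v r) Z) := by
  have := prob_inter_connIn_le (p := p) (E := Set.univ) hconn hdeg (fun _ _ _ h => h) hX hY hZ
  simpa using this

/-- Two disjoint open clusters of `A` that both meet `T` are no more likely than independent
connections. -/
lemma prob_disjoint_clusters_le (hconn : G.Connected) (hdeg : BoundedDegree G)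
    (hA : A ⊆ ball G v n) (x x' : V) :
    prob G p {ω | (∃ t ∈ T, Joined (openGraph G ω) A x t) ∧
      (∃ t ∈ T, Joined (openGraph G ω) A x' t) ∧ ¬ Joined (openGraph G ω) A x x'} ≤
      prob G p (connIn G {x} T A) * prob G p (connIn G {x'} T A) := by
  classical
  have hAfin : A.Finite := (ball_finite hconn hdeg v n).subset hA
  have hfin : {U : Set V | U ⊆ A ∧ x ∈ U ∧ (U ∩ T).Nonempty}.Finite :=
    hAfin.finite_subsets.subset fun U hU => hU.1
  have hmem : ∀ U, U ∈ hfin.toFinset ↔ U ⊆ A ∧ x ∈ U ∧ (U ∩ T).Nonempty := by simp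
  have hat : ∀ U ⊆ A, (edgesAt G U).Finite := fun U hU =>
    (edgesIn_finite (ball_finite hconn hdeg v (n + 1))).subset (edgesAt_subset hconn (hU.trans hA))
  -- Sum over the possible clusters `U` of `x`: the path from `x'` avoids `U`, so it uses none of
  -- the edges that determine `U`.
  refine (prob_mono (B := {ω | ∃ U ∈ hfin.toFinset,
    ω ∈ isCluster G A U ∩ connIn G {x'} T (A \ U)}) ?_).trans ((prob_iUnion_le _ _).trans ?_)
  · rintro ω ⟨⟨t, ht, h1⟩, ⟨t', ht', h2⟩, h3⟩
    have hcl := isCluster_setOf_joined (ω := ω) A x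
    refine ⟨{b | Joined (openGraph G ω) A x b}, ?_, hcl, x', rfl, t', ht', ?_⟩
    · rw [hmem]
      exact ⟨fun b hb => hb.right_mem, Joined.refl h1.left_mem, t, h1, ht⟩
    · refine (h2.inter_of_closed (T := {b | ¬ Joined (openGraph G ω) A x b}) h3 ?_).mono ?_
      · exact fun a ha b hb hab h => ha.2 (h.concat hab.symm ha.1)
      · exact fun b hb => ⟨hb.1, hb.2⟩
  · calc ∑ U ∈ hfin.toFinset, prob G p (isCluster G A U ∩ connIn G {x'} T (A \ U))
        ≤ ∑ U ∈ hfin.toFinset, prob G p (isCluster G A U) * prob G p (connIn G {x'} T A) := by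
          refine Finset.sum_le_sum fun U hU => ?_
          rw [hmem] at hU
          rw [depOn_isCluster.prob_inter depOn_connIn (hat U hU.1)
            (edgesIn_finite (hAfin.subset Set.sdiff_subset))
            (disjoint_edgesAt_edgesIn Set.disjoint_sdiff_right)]
          exact mul_le_mul_of_nonneg_left
            (prob_mono (connIn_mono subset_rfl subset_rfl Set.sdiff_subset)) prob_nonneg
      _ = (∑ U ∈ hfin.toFinset, prob G p (isCluster G A U)) * prob G p (connIn G {x'} T A) := by
          rw [Finset.sum_mul]
      _ ≤ _ := by
          refine mul_le_mul_of_nonneg_right (sum_prob_le _ _ ?_ ?_ ?_) prob_nonneg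
          · intro U hU
            rw [hmem] at hU
            exact depOn_isCluster.measurableSet (hat U hU.1)
          · intro U hU ω hω
            obtain ⟨-, hx, t, htU, htT⟩ := (hmem U).1 hU
            exact ⟨x, rfl, t, htT, (hω x hx t).2 htU⟩
          · intro U hU U' hU' hne
            rw [hmem] at hU hU'
            refine Set.disjoint_left.2 fun ω h h' => hne ?_
            exact eq_of_mem_isCluster h h' hU.2.1 hU'.2.1
              (Joined.refl (hU.1 hU.2.1))

end Edges

open Filter Topology

/-! ### Infinite clusters as limits of connections to spheres -/

section Infinite

variable {V : Type*} {G : SimpleGraph V} {v w x y : V} {X Y Z Z' : Set V} {n : ℕ}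
  {p q : unitInterval} {ω : Config G} {E : Set (Config G)}

/-- The event that `x` is joined to the sphere `S(v, n)` inside the ball `B(v, n)`. -/
def reach (G : SimpleGraph V) (v x : V) (n : ℕ) : Set (Config G) :=
  connIn G {x} (sphere G v n) (ball G v n)

lemma mem_reach : ω ∈ reach G v x n ↔
    ∃ t ∈ sphere G v n, Joined (openGraph G ω) (ball G v n) x t := by
  simp [reach, mem_connIn]

lemma connIn_subset_reach (hconn : G.Connected) (hx : G.dist v x ≤ n)
    (hY : ∀ y ∈ Y, n ≤ G.dist v y) : connIn G {x} Y Z ⊆ reach G v x n := by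
  rintro ω ⟨_, rfl, y, hy, h⟩
  obtain ⟨t, ht, h1, -⟩ :=
    Joined.exists_sphere (n := n) (openGraph_le ω) hconn (Z := Z) h hx (hY y hy)
  exact mem_reach.2 ⟨t, ht, h1.mono Set.inter_subset_right⟩

lemma reach_anti (hconn : G.Connected) {m : ℕ} (hx : G.dist v x ≤ n) (hnm : n ≤ m) :
    reach G v x m ⊆ reach G v x n :=
  connIn_subset_reach hconn hx fun y hy => by rw [mem_sphere_iff] at hy; omega

lemma conn_sphere_eq_reach (hconn : G.Connected) (w : V) (n : ℕ) :
    conn G {w} (sphere G w n) = reach G w w n := by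
  refine Set.Subset.antisymm (connIn_subset_reach hconn (by simp) fun y hy => ?_)
    (connIn_mono subset_rfl subset_rfl (Set.subset_univ _))
  rw [mem_sphere_iff] at hy; exact hy.ge

/-- An infinite cluster leaves every finite ball, and a cluster reaching all remote spheres is
infinite. The shift by `G.dist v x` keeps `x` inside the ball, where the events decrease. -/
lemma clusterInfinite_eq_iInter (hconn : G.Connected) (hdeg : BoundedDegree G) (v x : V) :
    clusterInfinite G x = ⋂ n, reach G v x (n + G.dist v x) := by
  ext ω
  simp only [Set.mem_iInter]
  constructor
  · intro h n
    have hω : (cluster G ω x).Infinite := h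
    obtain ⟨y, ⟨π⟩, hy⟩ := hω.exists_notMem_finite (ball_finite hconn hdeg v (n + G.dist v x))
    refine connIn_subset_reach (Y := {y}) (Z := Set.univ) hconn (by omega) ?_
      ⟨x, rfl, y, rfl, π, by simp⟩
    rintro _ rfl
    rw [mem_ball_iff] at hy; omega
  · intro h
    refine Set.Infinite.of_image (G.dist v) ((Set.Ici_infinite (G.dist v x)).mono ?_)
    intro n hn
    obtain ⟨k, rfl⟩ := Nat.exists_eq_add_of_le' hn
    obtain ⟨t, ht, π, -⟩ := mem_reach.1 (h k)
    exact ⟨t, ⟨π⟩, ht⟩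

lemma measurableSet_reach (hconn : G.Connected) (hdeg : BoundedDegree G) :
    MeasurableSet (reach G v x n) := measurableSet_connIn (ball_finite hconn hdeg v n)

lemma measurableSet_clusterInfinite (hconn : G.Connected) (hdeg : BoundedDegree G) (x : V) :
    MeasurableSet (clusterInfinite G x) := by
  rw [clusterInfinite_eq_iInter hconn hdeg x x]
  exact MeasurableSet.iInter fun n => measurableSet_reach hconn hdeg

lemma clusterInfinite_subset_reach (hconn : G.Connected) (hdeg : BoundedDegree G)
    (hx : G.dist v x ≤ n) : clusterInfinite G x ⊆ reach G v x n := by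
  rw [clusterInfinite_eq_iInter hconn hdeg v x]
  obtain ⟨k, rfl⟩ := Nat.exists_eq_add_of_le' hx
  exact Set.iInter_subset _ k

lemma tendsto_prob_inter_reach (hconn : G.Connected) (hdeg : BoundedDegree G)
    (hE : MeasurableSet E) (v x : V) (p : unitInterval) :
    Tendsto (fun n => prob G p (E ∩ reach G v x n)) atTop
      (𝓝 (prob G p (E ∩ clusterInfinite G x))) := by
  rw [← tendsto_add_atTop_iff_nat (G.dist v x), clusterInfinite_eq_iInter hconn hdeg v x,
    Set.inter_iInter]
  refine (ENNReal.tendsto_toReal (measure_ne_top _ _)).comp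
    (tendsto_measure_iInter_atTop (fun n => ?_) ?_ ⟨0, measure_ne_top _ _⟩)
  · exact (hE.inter (measurableSet_reach hconn hdeg)).nullMeasurableSet
  · intro a b hab
    exact Set.inter_subset_inter_right _ (reach_anti hconn (by omega) (by omega))

lemma tendsto_prob_reach (hconn : G.Connected) (hdeg : BoundedDegree G)
    (v x : V) (p : unitInterval) :
    Tendsto (fun n => prob G p (reach G v x n)) atTop (𝓝 (prob G p (clusterInfinite G x))) := by
  simpa using tendsto_prob_inter_reach hconn hdeg MeasurableSet.univ v x p

lemma joined_openEdges [DecidableEq V] {F : Finset G.edgeSet} (hF : edgesIn G Z ⊆ F)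
    (h : Joined G Z x y) : Joined (openGraph G (openEdges F ω)) Z x y := by
  refine h.imp_graph fun a ha b hb hab => ⟨hab, ?_⟩
  have : (⟨s(a, b), hab⟩ : G.edgeSet) ∈ F := hF fun c hc => by
    rcases Sym2.mem_iff.1 hc with rfl | rfl <;> assumption
  simp [openEdges, this]

lemma openGraph_le_openEdges [DecidableEq V] (F : Finset G.edgeSet) (ω : Config G) :
    openGraph G ω ≤ openGraph G (openEdges F ω) := by
  rintro a b ⟨hab, h⟩
  refine ⟨hab, ?_⟩
  unfold openEdges
  split_ifs <;> simp [h]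

/-- Opening the edges in a finite set that joins `x` to `w`. -/
lemma exists_pow_mul_prob_connIn_le (hZ : Z.Finite) (h : Joined G Z w x) :
    ∃ k : ℕ, ∀ Z' : Set V, Z'.Finite → Z ⊆ Z' → ∀ (Y : Set V) (p : unitInterval),
      (p : ℝ) ^ k * prob G p (connIn G {x} Y Z') ≤ prob G p (connIn G {w} Y Z') := by
  classical
  refine ⟨(edgesIn_finite (G := G) hZ).toFinset.card, fun Z' hZ' hsub Y p => ?_⟩
  refine pow_card_mul_prob_le _ depOn_connIn (edgesIn_finite hZ') ?_
  rintro ω ⟨_, rfl, y, hy, h'⟩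
  refine ⟨w, rfl, y, hy, ((joined_openEdges (by simp) h).mono hsub).trans ?_⟩
  exact Joined.imp_graph (H := openGraph G ω) h' fun a _ b _ hab => openGraph_le_openEdges _ _ hab

lemma prob_connIn_pos (hZ : Z.Finite) (hp : 0 < p) (hx : x ∈ X) (hy : y ∈ Y)
    (h : Joined G Z x y) : 0 < prob G p (connIn G X Y Z) := by
  classical
  have := pow_card_mul_prob_le (p := p) (A := Set.univ) (edgesIn_finite (G := G) hZ).toFinset
    (depOn_connIn (X := X) (Y := Y) (Z := Z)) (edgesIn_finite hZ)
    fun ω _ => ⟨x, hx, y, hy, joined_openEdges (by simp) h⟩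
  refine lt_of_lt_of_le ?_ this
  have h1 : prob G p (Set.univ : Set (Config G)) = 1 := by simp [prob]
  rw [h1, mul_one]
  exact pow_pos (by exact_mod_cast hp) _

lemma exists_pow_mul_prob_clusterInfinite_le (hconn : G.Connected) (hdeg : BoundedDegree G)
    (w x : V) : ∃ k : ℕ, ∀ p : unitInterval,
      (p : ℝ) ^ k * prob G p (clusterInfinite G x) ≤ prob G p (clusterInfinite G w) := by
  obtain ⟨k, hk⟩ := exists_pow_mul_prob_connIn_le (ball_finite hconn hdeg w (G.dist w x))
    (joined_ball hconn w x)
  refine ⟨k, fun p => ?_⟩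
  refine le_of_tendsto_of_tendsto ((tendsto_prob_reach hconn hdeg w x p).const_mul _)
    (tendsto_prob_reach hconn hdeg w w p) ?_
  filter_upwards [eventually_ge_atTop (G.dist w x)] with n hn
  exact hk _ (ball_finite hconn hdeg w n) (ball_mono hn) _ p

lemma exists_mem_sphere [Infinite V] (hconn : G.Connected) (hdeg : BoundedDegree G) (v : V)
    (n : ℕ) : (sphere G v n).Nonempty := by
  obtain ⟨y, -, hy⟩ := (Set.infinite_univ (α := V)).exists_notMem_finite
    (ball_finite hconn hdeg v n)
  obtain ⟨t, ht, -⟩ := (joined_ball hconn v y).exists_sphere (v := v) le_rfl hconn (n := n) (by simp)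
    (by rw [mem_ball_iff] at hy; omega)
  exact ⟨t, ht⟩

lemma prob_reach_pos [Infinite V] (hconn : G.Connected) (hdeg : BoundedDegree G) (hp : 0 < p)
    (hw : G.dist v w ≤ n) : 0 < prob G p (reach G v w n) := by
  obtain ⟨t, ht⟩ := exists_mem_sphere hconn hdeg v n
  have h1 := (joined_ball hconn v w).mono (ball_mono hw)
  have h2 := joined_ball hconn v t
  rw [mem_sphere_iff.1 ht] at h2
  exact prob_connIn_pos (ball_finite hconn hdeg v n) hp rfl ht (h1.symm.trans h2)

lemma prob_clusterInfinite_mono (hconn : G.Connected) (hdeg : BoundedDegree G) (x : V)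
    (hpq : p ≤ q) : prob G p (clusterInfinite G x) ≤ prob G q (clusterInfinite G x) := by
  refine prob_mono_param (measurableSet_clusterInfinite hconn hdeg x) ?_ hpq
  intro ω ω' h hω
  refine Set.Infinite.mono ?_ (show (cluster G ω x).Infinite from hω)
  have hle : openGraph G ω ≤ openGraph G ω' := fun a b hab => ⟨hab.1, h _ hab.2⟩
  exact fun y hy => SimpleGraph.Reachable.mono hle hy

end Infinite

/-! ### Positivity of the critical parameter -/

section Peierls

variable {V : Type*} {G : SimpleGraph V} {x : V} {n : ℕ} {p : unitInterval} {ω : Config G}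

/-- The event that a self-avoiding open path of length `n` starts at `x` and avoids `F`. -/
def openPathFrom (G : SimpleGraph V) : ℕ → V → Set V → Set (Config G)
  | 0, _, _ => Set.univ
  | n + 1, x, F => {ω | ∃ y, (openGraph G ω).Adj x y ∧ y ∉ insert x F ∧
      ω ∈ openPathFrom G n y (insert x F)}

lemma mem_openPathFrom {y : V} (π : (openGraph G ω).Walk x y) (hπ : π.IsPath) (F : Set V)
    (hF : ∀ z ∈ π.support, z ∉ F) (hn : n ≤ π.length) : ω ∈ openPathFrom G n x F := by
  induction π generalizing n F with
  | nil =>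
    obtain rfl : n = 0 := by simpa using hn
    trivial
  | @cons a b c hab π ih =>
    cases n with
    | zero => trivial
    | succ n =>
      rw [SimpleGraph.Walk.cons_isPath_iff] at hπ
      have h1 : ∀ z ∈ π.support, z ∉ insert a F := by
        rintro z hz (rfl | h)
        · exact hπ.2 hz
        · exact hF z (by simp [hz]) h
      exact ⟨b, hab, h1 b π.start_mem_support, ih hπ.1 _ h1 (by simpa using hn)⟩

lemma depOn_openPathFrom (hconn : G.Connected) (v : V) {F : Set V} {m : ℕ} (hx : x ∉ F)
    (hm : G.dist v x + n ≤ m) : DepOn (openPathFrom G n x F) (edgesIn G (ball G v m \ F)) := by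
  induction n generalizing x F with
  | zero => exact fun _ _ _ _ => trivial
  | succ n ih =>
    rintro ω ω' hω ⟨y, hxy, hy, h⟩
    have hd := dist_le_succ (v := v) hconn (openGraph_le ω hxy)
    refine ⟨y, openGraph_adj_congr (fun e he => hω e ?_) hxy, hy,
      ih hy (by omega) ω ω' (fun e he => hω e (edgesIn_mono ?_ he)) h⟩
    · intro c hc
      rw [he, Sym2.mem_iff] at hc
      rcases hc with rfl | rfl
      · exact ⟨by rw [mem_ball_iff]; omega, hx⟩
      · exact ⟨by rw [mem_ball_iff]; omega, fun h => hy (Or.inr h)⟩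
    · exact Set.sdiff_subset_sdiff_right (Set.subset_insert _ _)

/-- There are at most `D` first edges. The first edge touches `x`, while the rest of the path avoids
`x`, so the two are independent. -/
lemma prob_openPathFrom_le (hconn : G.Connected) (hdeg : BoundedDegree G) {D : ℕ}
    (hD : ∀ x : V, (G.neighborSet x).encard ≤ (D : ℕ∞)) (F : Set V) (hx : x ∉ F) :
    prob G p (openPathFrom G n x F) ≤ (D * (p : ℝ)) ^ n := by
  induction n generalizing x F with
  | zero => simpa using prob_le_one
  | succ n ih =>
    have hfin : (G.neighborSet x).Finite :=
      Set.encard_ne_top_iff.1 (ne_top_of_le_ne_top (ENat.natCast_ne_top D) (hD x))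
    have hcard : (hfin.toFinset.card : ℝ) ≤ D := by
      have := hD x
      rw [hfin.encard_eq_coe_toFinset_card] at this
      exact_mod_cast this
    have hsub : openPathFrom G (n + 1) x F ⊆ {ω | ∃ y ∈ hfin.toFinset,
        ω ∈ {ω : Config G | (openGraph G ω).Adj x y} ∩
          {ω | y ∉ insert x F ∧ ω ∈ openPathFrom G n y (insert x F)}} := by
      rintro ω ⟨y, hxy, hy, h⟩
      exact ⟨y, by simpa using openGraph_le ω hxy, hxy, hy, h⟩
    have hp0 : (0 : ℝ) ≤ p := p.2.1
    refine (prob_mono hsub).trans ((prob_iUnion_le _ _).trans ?_)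
    calc _ ≤ ∑ y ∈ hfin.toFinset, (p : ℝ) * (D * (p : ℝ)) ^ n := by
          refine Finset.sum_le_sum fun y hy => ?_
          have hxy : G.Adj x y := by simpa using hy
          by_cases hyF : y ∈ insert x F
          · simp only [hyF, not_true_eq_false, false_and, Set.ofPred_false, Set.inter_empty]
            simp only [prob, measureReal_empty]
            positivity
          · simp only [hyF, not_false_eq_true, true_and]
            have h1 : {ω : Config G | (openGraph G ω).Adj x y}
                = {ω | ∀ e ∈ ({⟨s(x, y), hxy⟩} : Finset G.edgeSet), ω e = true} := by
              ext ω
              simp only [Finset.mem_singleton, forall_eq, Set.mem_ofPred_eq]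
              exact ⟨fun h => h.2, fun h => ⟨hxy, h⟩⟩
            have hdep : DepOn {ω : Config G | (openGraph G ω).Adj x y} {⟨s(x, y), hxy⟩} := by
              intro ω ω' hω h
              refine openGraph_adj_congr (fun e he => hω e ?_) h
              exact Subtype.ext he
            have h2 := depOn_openPathFrom (n := n) (F := insert x F) hconn x hyF le_rfl
            change prob G p ({ω : Config G | (openGraph G ω).Adj x y} ∩
              openPathFrom G n y (insert x F)) ≤ _
            rw [hdep.prob_inter h2 (Set.finite_singleton _)
              (edgesIn_finite ((ball_finite hconn hdeg x _).subset Set.sdiff_subset))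
              (Set.disjoint_left.2 ?_), h1, prob_all_open]
            · simpa using mul_le_mul_of_nonneg_left (ih _ hyF) hp0
            · rintro e rfl h
              exact (h x (by simp)).2 (by simp)
      _ = hfin.toFinset.card * ((p : ℝ) * (D * (p : ℝ)) ^ n) := by simp
      _ ≤ D * ((p : ℝ) * (D * (p : ℝ)) ^ n) := by gcongr
      _ = _ := by ring

/-- Needed so that finite-energy arguments at `p_c` cost a positive factor. -/
lemma pc_pos (hconn : G.Connected) (hdeg : BoundedDegree G) : 0 < pc G := by
  obtain ⟨D, hD⟩ := hdeg
  have hD' : (0 : ℝ) < 2 * (D + 1) := by positivity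
  -- Below this value `D * p ≤ 1 / 2`, so long open paths are exponentially unlikely; the `+ 1`
  -- avoids division by zero.
  let p₀ : unitInterval := ⟨1 / (2 * (D + 1)), by positivity, by
    rw [div_le_one hD']; have : (0 : ℝ) ≤ D := by positivity
    linarith⟩
  have h0 : 0 < p₀ := by
    rw [← Subtype.coe_lt_coe]; exact div_pos one_pos hD'
  refine h0.trans_le (le_sInf ?_)
  rintro p ⟨v, hv⟩
  by_contra hlt
  rw [not_le, ← Subtype.coe_lt_coe] at hlt
  have hlt : (p : ℝ) < 1 / (2 * (D + 1)) := hlt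
  have hp0 : (0 : ℝ) ≤ p := p.2.1
  have hDp : D * (p : ℝ) ≤ 1 / 2 := by
    rw [lt_div_iff₀ hD'] at hlt
    nlinarith
  have hle : ∀ n, prob G p (clusterInfinite G v) ≤ (1 / 2 : ℝ) ^ n := by
    intro n
    refine (prob_mono (B := openPathFrom G n v ∅) ?_).trans
      ((prob_openPathFrom_le hconn ⟨D, hD⟩ hD ∅ (by simp)).trans ?_)
    · intro ω hω
      obtain ⟨t, ht, π, -⟩ := mem_reach.1
        (clusterInfinite_subset_reach (v := v) (n := n) hconn ⟨D, hD⟩ (by simp) hω)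
      classical
      refine mem_openPathFrom π.bypass π.bypass_isPath ∅ (by simp) ?_
      have h1 := SimpleGraph.dist_le (π.bypass.mapLe (openGraph_le ω))
      rw [mem_sphere_iff.1 ht] at h1
      simpa using h1
    · exact pow_le_pow_left₀ (by positivity) hDp n
  have := ge_of_tendsto' (tendsto_pow_atTop_nhds_zero_of_lt_one (by norm_num)
    (by norm_num : (1 / 2 : ℝ) < 1)) hle
  linarith

lemma prob_clusterInfinite_pos (hconn : G.Connected) (hdeg : BoundedDegree G) (w : V)
    (hp : pc G < p) : 0 < prob G p (clusterInfinite G w) := by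
  obtain ⟨q, ⟨v, hv⟩, hqp⟩ := sInf_lt_iff.1 hp
  obtain ⟨k, hk⟩ := exists_pow_mul_prob_clusterInfinite_le hconn hdeg w v
  have h0 : 0 < p := (pc_pos hconn hdeg).trans hp
  refine lt_of_lt_of_le (mul_pos (pow_pos (by exact_mod_cast h0) k) ?_) (hk p)
  exact hv.trans_le (prob_clusterInfinite_mono hconn hdeg v hqp.le)

end Peierls

/-! ### One-endedness, and quasi-multiplicativity around a hole -/

lemma induce_connected_of_joined {V : Type*} {G : SimpleGraph V} {Z : Set V} {u : V} (hu : u ∈ Z)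
    (h : ∀ z ∈ Z, Joined G Z u z) : (G.induce Z).Connected := by
  have : Nonempty Z := ⟨⟨u, hu⟩⟩
  refine SimpleGraph.Connected.mk fun a b => ?_
  have key : ∀ z (hz : z ∈ Z), (G.induce Z).Reachable ⟨u, hu⟩ ⟨z, hz⟩ := by
    intro z hz
    obtain ⟨π, hπ⟩ := h z hz
    exact ⟨π.induce Z hπ⟩
  exact (key a a.2).symm.trans (key b b.2)

section OneEnded

variable {V : Type*} {G : SimpleGraph V} {v : V} {p : unitInterval} {c : ℝ} {K m : ℕ}
  {I I' : Set V}

lemma tendsto_prob_connIn_ball_sphere (hconn : G.Connected) (hdeg : BoundedDegree G)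
    (h0 : ∀ x, prob G p (clusterInfinite G x) = 0) (v : V) (K : ℕ) :
    Tendsto (fun n => prob G p (connIn G (ball G v K) (sphere G v n) (ball G v n))) atTop (𝓝 0) := by
  have hfin := ball_finite hconn hdeg v K
  have h1 : Tendsto (fun n => ∑ x ∈ hfin.toFinset, prob G p (reach G v x n)) atTop (𝓝 0) := by
    have := tendsto_finsetSum hfin.toFinset fun x _ => tendsto_prob_reach hconn hdeg v x p
    simpa [h0] using this
  refine tendsto_of_tendsto_of_tendsto_of_le_of_le tendsto_const_nhds h1 (fun n => prob_nonneg)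
    fun n => ?_
  refine (prob_mono ?_).trans (prob_iUnion_le hfin.toFinset fun x => reach G v x n)
  rintro ω ⟨x, hx, t, ht, h⟩
  exact ⟨x, by simpa using hx, x, rfl, t, ht, h⟩

/-- The part of `I ∪ B(v, K)` inside `B(v, n)`. -/
def armRegion (G : SimpleGraph V) (v : V) (K : ℕ) (I : Set V) (n : ℕ) : Set V :=
  (I ∪ ball G v K) ∩ ball G v n

/-- The event that `B(v, K)` is joined to `S(v, n)` through `I`. -/
def armEvent (G : SimpleGraph V) (v : V) (K : ℕ) (I : Set V) (n : ℕ) : Set (Config G) :=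
  connIn G (ball G v K) (sphere G v n) (armRegion G v K I n)

lemma prob_armEvent_pos (hconn : G.Connected) (hdeg : BoundedDegree G) (hp : 0 < p) (hm : K < m)
    (hclosed : ∀ a ∈ I, ∀ b, G.Adj a b → b ∉ ball G v K → b ∈ I)
    (hunb : ∀ n, ∃ x ∈ I, n ≤ G.dist v x) : 0 < prob G p (armEvent G v K I m) := by
  obtain ⟨x, hxI, hx⟩ := hunb m
  obtain ⟨t, u, -, h2, h3, h4⟩ := (joined_ball hconn v x).last_exit (T := ball G v K)
    self_mem_ball (by rw [mem_ball_iff]; omega)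
  have h5 : Joined G I u x :=
    ((h4.symm.inter_of_closed (T := I) hxI fun a ha b hb hab =>
      hclosed a ha.2 b hab hb.2).mono Set.inter_subset_right).symm
  have h6 : G.dist v t ≤ K := h2
  have h7 := dist_le_succ (v := v) hconn h3
  obtain ⟨s, hs, h8, -⟩ := h5.exists_sphere (v := v) (n := m) le_rfl hconn (by omega) hx
  refine prob_connIn_pos ((ball_finite hconn hdeg v m).subset Set.inter_subset_right) hp h2 hs
    (Joined.cons h3 ⟨Or.inr h2, by rw [mem_ball_iff]; omega⟩ (h8.mono ?_))
  exact fun z hz => ⟨Or.inl hz.1, hz.2⟩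

/-- Quasi-multiplicativity is applied to `X ⊆ I'` on `S(v, m)` and `Y ⊆ I` beyond `4m`. As `I` can
only be left through `B(v, K)`, every path from `Y` to `X` contains a full arm in `I`. The factor of
`Y` cancels, so the part of an `I'`-arm between `m` and `2m` is bounded by an `I`-arm. -/
lemma mul_prob_armEvent_le [Infinite V] (hconn : G.Connected) (hdeg : BoundedDegree G) (hp : 0 < p)
    (hc : 0 < c) (hqm : QuasiMultiplicative G v p c) (hm : K < m)
    (hclosed : ∀ a ∈ I, ∀ b, G.Adj a b → b ∉ ball G v K → b ∈ I)
    (hunb : ∀ n, ∃ x ∈ I, n ≤ G.dist v x) (hd : Disjoint I I') :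
    c * prob G p (armEvent G v K I' (2 * m)) ≤
      prob G p (armEvent G v K I' m) * prob G p (armEvent G v K I (2 * m)) := by
  set Z := ball G v (4 * m + 1) with hZ
  have hZfin : Z.Finite := ball_finite hconn hdeg v _
  set X := I' ∩ sphere G v m with hX
  set Y := I ∩ sphere G v (4 * m + 1) with hY
  set S := sphere G v (2 * m) with hS
  have hq := hqm m (by omega) Z hZfin
    (induce_connected_of_joined self_mem_ball fun z hz =>
      (joined_ball hconn v z).mono (ball_mono hz))
    (fun z hz => ball_mono (by omega) hz.1) X Y
    (fun z hz => ⟨sphere_subset_ball (by omega) hz.2, sphere_subset_ball le_rfl hz.2⟩)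
    (fun z hz => ⟨sphere_subset_ball le_rfl hz.2, by
      have := mem_sphere_iff.1 hz.2
      rw [mem_ball_iff]; omega⟩)
  have hYS : 0 < prob G p (connIn G Y S Z) := by
    obtain ⟨x, hxI, hx⟩ := hunb (4 * m + 1)
    obtain ⟨t, u, -, h2, h3, h4⟩ := (joined_ball hconn v x).last_exit (T := ball G v K)
      self_mem_ball (by rw [mem_ball_iff]; omega)
    have h5 : Joined G I u x :=
      ((h4.symm.inter_of_closed (T := I) hxI fun a ha b hb hab =>
        hclosed a ha.2 b hab hb.2).mono Set.inter_subset_right).symm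
    have h6 : G.dist v t ≤ K := h2
    have h7 := dist_le_succ (v := v) hconn h3
    obtain ⟨y, hy, h8, -⟩ := h5.exists_sphere (v := v) (n := 4 * m + 1) le_rfl hconn (by omega) hx
    obtain ⟨s, hs, -, h9⟩ := (h8.mono Set.inter_subset_right).exists_sphere (v := v) (n := 2 * m)
      le_rfl hconn (by omega) (by rw [mem_sphere_iff.1 hy]; omega)
    exact prob_connIn_pos hZfin hp (show y ∈ Y from ⟨h8.right_mem.1, hy⟩) hs h9.symm
  have h1 : prob G p (connIn G X Y Z) ≤
      prob G p (armEvent G v K I (2 * m)) * prob G p (connIn G Y S Z) := by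
    have hsub : connIn G X Y Z ⊆ connIn G (ball G v K) Y (armRegion G v K I (4 * m + 1)) := by
      rintro ω ⟨x, hx, y, hy, h⟩
      have h : Joined (openGraph G ω) Z x y := h
      obtain ⟨u, t, h1, h2, h3, h4⟩ := h.symm.first_hit (T := Iᶜ) (by simpa using hy.1)
        (Set.disjoint_right.1 hd hx.1)
      rw [sdiff_compl] at h1
      have htK : t ∈ ball G v K := by
        by_contra htK
        exact h3 (hclosed u h1.right_mem.2 t (openGraph_le ω h2) htK)
      refine ⟨t, htK, y, hy, Joined.cons h2.symm ⟨Or.inr htK, h4.left_mem⟩ ?_⟩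
      exact h1.symm.mono fun z hz => ⟨Or.inl hz.2, hz.1⟩
    refine (prob_mono hsub).trans ((prob_connIn_le (r := 2 * m) hconn hdeg (ball_mono (by omega))
      (fun y hy => by rw [mem_sphere_iff.1 hy.2]; omega)
      (hZfin.subset Set.inter_subset_right)).trans ?_)
    refine mul_le_mul (prob_mono (connIn_mono subset_rfl subset_rfl ?_))
      (prob_mono (connIn_mono subset_rfl subset_rfl Set.inter_subset_right)) prob_nonneg prob_nonneg
    exact fun z hz => ⟨hz.1.1, hz.2⟩
  have h2 : prob G p (armEvent G v K I' (2 * m)) ≤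
      prob G p (armEvent G v K I' m) * prob G p (connIn G X S Z) := by
    refine (prob_connIn_le (r := m) hconn hdeg (ball_mono hm.le)
      (fun y hy => by rw [mem_sphere_iff.1 hy]; omega)
      ((ball_finite hconn hdeg v (2 * m)).subset Set.inter_subset_right)).trans ?_
    refine mul_le_mul (prob_mono (connIn_mono subset_rfl subset_rfl ?_))
      (prob_mono ?_) prob_nonneg prob_nonneg
    · exact fun z hz => ⟨hz.1.1, hz.2⟩
    · rintro ω ⟨y, hy, t, ht, h⟩
      have h : Joined (openGraph G ω) (armRegion G v K I' (2 * m)) y t := h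
      refine ⟨t, ⟨h.right_mem.1.resolve_right ?_, ht⟩, y, hy, h.symm.mono ?_⟩
      · rw [mem_ball_iff, mem_sphere_iff.1 ht]; omega
      · exact fun z hz => ball_mono (by omega) hz.2
  have h3 : c * prob G p (connIn G X S Z) ≤ prob G p (armEvent G v K I (2 * m)) :=
    le_of_mul_le_mul_right (hq.trans h1) hYS
  calc c * prob G p (armEvent G v K I' (2 * m))
      ≤ c * (prob G p (armEvent G v K I' m) * prob G p (connIn G X S Z)) := by gcongr
    _ = prob G p (armEvent G v K I' m) * (c * prob G p (connIn G X S Z)) := by ring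
    _ ≤ _ := mul_le_mul_of_nonneg_left h3 prob_nonneg

/-- Without percolation, quasi-multiplicativity forces the graph to have one end. -/
lemma joined_of_unbounded [Infinite V] (hconn : G.Connected) (hdeg : BoundedDegree G) (hp : 0 < p)
    (h0 : ∀ x, prob G p (clusterInfinite G x) = 0)
    (hc : 0 < c) (hqm : QuasiMultiplicative G v p c) {s s' : V}
    (hs : ∀ n, ∃ x, Joined G (ball G v K)ᶜ s x ∧ n ≤ G.dist v x)
    (hs' : ∀ n, ∃ x, Joined G (ball G v K)ᶜ s' x ∧ n ≤ G.dist v x) :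
    Joined G (ball G v K)ᶜ s s' := by
  by_contra hne
  set I : Set V := {x | Joined G (ball G v K)ᶜ s x}
  set I' : Set V := {x | Joined G (ball G v K)ᶜ s' x}
  have hclosed : ∀ a ∈ I, ∀ b, G.Adj a b → b ∉ ball G v K → b ∈ I :=
    fun a ha b hab hb => Joined.concat ha hab hb
  have hclosed' : ∀ a ∈ I', ∀ b, G.Adj a b → b ∉ ball G v K → b ∈ I' :=
    fun a ha b hab hb => Joined.concat ha hab hb
  have hd : Disjoint I I' :=
    Set.disjoint_left.2 fun a ha hb => hne (Joined.trans ha (Joined.symm hb))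
  -- At this `m` both arm probabilities are below `c`, so `k1` and `k2` make each of two positive
  -- numbers at scale `2m` strictly smaller than the other.
  obtain ⟨m, hmK, hmc⟩ := ((eventually_gt_atTop K).and
    ((tendsto_prob_connIn_ball_sphere hconn hdeg h0 v K).eventually_lt_const hc)).exists
  have hle : ∀ J : Set V, prob G p (armEvent G v K J m) < c := fun J =>
    (prob_mono (connIn_mono subset_rfl subset_rfl Set.inter_subset_right)).trans_lt hmc
  have k1 := mul_prob_armEvent_le hconn hdeg hp hc hqm hmK hclosed hs hd
  have k2 := mul_prob_armEvent_le hconn hdeg hp hc hqm hmK hclosed' hs' hd.symm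
  have p1 := prob_armEvent_pos (m := 2 * m) hconn hdeg hp (by omega) hclosed hs
  have p2 := prob_armEvent_pos (m := 2 * m) hconn hdeg hp (by omega) hclosed' hs'
  have l1 := hle I
  have l2 := hle I'
  have n1 : 0 ≤ prob G p (armEvent G v K I m) := prob_nonneg
  have n2 : 0 ≤ prob G p (armEvent G v K I' m) := prob_nonneg
  rcases le_total (prob G p (armEvent G v K I (2 * m))) (prob G p (armEvent G v K I' (2 * m)))
    with h | h
  · have := mul_le_mul_of_nonneg_left h n2
    nlinarith
  · have := mul_le_mul_of_nonneg_left h n1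
    nlinarith

/-- The property that vertices far from `v` are joined off `B(v, K)` without going further away. -/
def OneEndedAt (G : SimpleGraph V) (v : V) : Prop :=
  ∀ K, ∃ M, K < M ∧ ∀ n, ∀ x ∈ ball G v n, ∀ y ∈ ball G v n, M ≤ G.dist v x → M ≤ G.dist v y →
    Joined G (ball G v n \ ball G v K) x y

/-- It suffices to look at the finitely many pairs in `S(v, K + 1)`. Either both points have
unbounded components off `B(v, K)`, and one fixed walk joins them, or one component is bounded and
does not reach distance `M`. -/
lemma oneEndedAt [Infinite V] (hconn : G.Connected) (hdeg : BoundedDegree G) (hp : 0 < p)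
    (h0 : ∀ x, prob G p (clusterInfinite G x) = 0)
    (hc : 0 < c) (hqm : QuasiMultiplicative G v p c) : OneEndedAt G v := by
  intro K
  have hfin : (sphere G v (K + 1)).Finite :=
    (ball_finite hconn hdeg v (K + 1)).subset (sphere_subset_ball le_rfl)
  have key : ∀ s s', ∃ M, ∀ n, M ≤ n →
      ((∃ x, Joined G (ball G v K)ᶜ s x ∧ n ≤ G.dist v x) →
      (∃ x, Joined G (ball G v K)ᶜ s' x ∧ n ≤ G.dist v x) →
      Joined G (ball G v n \ ball G v K) s s') := by
    intro s s'
    by_cases hs : ∀ n, ∃ x, Joined G (ball G v K)ᶜ s x ∧ n ≤ G.dist v x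
    · by_cases hs' : ∀ n, ∃ x, Joined G (ball G v K)ᶜ s' x ∧ n ≤ G.dist v x
      · obtain ⟨π, hπ⟩ := joined_of_unbounded hconn hdeg hp h0 hc hqm hs hs'
        obtain ⟨M, hM⟩ := (π.support.map (G.dist v)).toFinset.bddAbove
        refine ⟨M, fun n hn _ _ => ⟨π, fun z hz => ⟨(hM ?_).trans hn, hπ z hz⟩⟩⟩
        simpa using ⟨z, hz, rfl⟩
      · push Not at hs'
        obtain ⟨M, hM⟩ := hs'
        refine ⟨M, fun n hn _ ⟨x, hx, hnx⟩ => ?_⟩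
        have := hM x hx
        omega
    · push Not at hs
      obtain ⟨M, hM⟩ := hs
      refine ⟨M, fun n hn ⟨x, hx, hnx⟩ => ?_⟩
      have := hM x hx
      omega
  choose M hM using key
  obtain ⟨M₀, hM₀⟩ := ((hfin.prod hfin).image fun q : V × V => M q.1 q.2).bddAbove
  refine ⟨max M₀ (K + 1), by omega, fun n x hx y hy hMx hMy => ?_⟩
  obtain ⟨s, hs, h1⟩ := exists_joined_sphere (v := v) (x := x) (k := K) hconn (by omega)
  obtain ⟨s', hs', h1'⟩ := exists_joined_sphere (v := v) (x := y) (k := K) hconn (by omega)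
  have h2 : M s s' ≤ M₀ := hM₀ ⟨(s, s'), ⟨hs, hs'⟩, rfl⟩
  have hx' : G.dist v x ≤ n := hx
  have hy' : G.dist v y ≤ n := hy
  have h3 := hM s s' (max M₀ (K + 1)) (by omega)
    ⟨x, h1.mono fun z hz => hz.2, hMx⟩ ⟨y, h1'.mono fun z hz => hz.2, hMy⟩
  refine ((h1.mono ?_).symm.trans (h3.mono ?_)).trans (h1'.mono ?_)
  · exact Set.sdiff_subset_sdiff_left (ball_mono hx')
  · exact Set.sdiff_subset_sdiff_left (ball_mono (by omega))
  · exact Set.sdiff_subset_sdiff_left (ball_mono hy')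

/-- Quasi-multiplicativity at scale `m` in a region with a hole inside `B(v, K)`, where the region
is not assumed to be connected. -/
def HoleMultiplicative (G : SimpleGraph V) (v : V) (p : unitInterval) (c : ℝ) (K m : ℕ) : Prop :=
  ∀ Z : Set V, Z.Finite → ball G v (4 * m) ⊆ Z → ∀ H ⊆ ball G v K, ∀ X ⊆ ball G v m,
    ∀ Y : Set V, (∀ y ∈ Y, 4 * m < G.dist v y) →
      c * prob G p (connIn G X (sphere G v (2 * m)) (Z \ H)) *
        prob G p (connIn G Y (sphere G v (2 * m)) Z) ≤ prob G p (connIn G X Y (Z \ H))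

/-- By one-endedness the annulus lies in a single component `Z'` of `Z \ H`. The relevant
connections meet the annulus, hence stay in `Z'`, which is connected, so quasi-multiplicativity
applies there. The threshold `M` is geometric and serves every `p`. -/
lemma exists_holeMultiplicative [Infinite V] (hconn : G.Connected) (hdeg : BoundedDegree G)
    (hone : OneEndedAt G v) (K : ℕ) :
    ∃ M, K < M ∧ ∀ m, M ≤ m → ∀ (p : unitInterval) (c : ℝ), 0 ≤ c → QuasiMultiplicative G v p c →
      HoleMultiplicative G v p c K m := by
  obtain ⟨M, hKM, hM⟩ := hone K
  refine ⟨M, hKM, fun m hm p c hc hqm => ?_⟩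
  intro Z hZ hball H hH X hX Y hY
  set Z' : Set V := {z | ∃ a ∈ annulus G v m (4 * m), Joined G (Z \ H) a z} with hZ'
  have hbd : ball G v (4 * m) \ ball G v K ⊆ Z \ H := Set.sdiff_subset_sdiff hball hH
  have hann : ∀ a ∈ annulus G v m (4 * m), ∀ b ∈ annulus G v m (4 * m), Joined G (Z \ H) a b := by
    intro a ha b hb
    have h1 : ¬ G.dist v a ≤ m - 1 := ha.2
    have h2 : ¬ G.dist v b ≤ m - 1 := hb.2
    exact (hM (4 * m) a ha.1 b hb.1 (by omega) (by omega)).mono hbd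
  have hS : sphere G v (2 * m) ⊆ annulus G v m (4 * m) := by
    intro a ha
    rw [mem_sphere_iff] at ha
    refine ⟨by rw [mem_ball_iff]; omega, by rw [mem_ball_iff]; omega⟩
  have hsub : Z' ⊆ Z \ H := fun z ⟨a, _, h⟩ => h.right_mem
  have hclosed : ∀ a ∈ (Z \ H) ∩ Z', ∀ b ∈ Z \ H, G.Adj a b → b ∈ Z' :=
    fun a ⟨_, a', ha', h⟩ b hb hab => ⟨a', ha', h.concat hab hb⟩
  have hAZ : annulus G v m (4 * m) ⊆ Z' := fun a ha => ⟨a, ha, hann a ha a ha⟩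
  obtain ⟨a₀, ha₀⟩ := exists_mem_sphere hconn hdeg v (2 * m)
  have hq := hqm m (by omega) Z' (hZ.subset (hsub.trans Set.sdiff_subset))
    (induce_connected_of_joined (hAZ (hS ha₀)) fun z ⟨a, ha, h⟩ =>
      (((hann a₀ (hS ha₀) a ha).trans h).inter_of_closed (hAZ (hS ha₀)) hclosed).mono
        Set.inter_subset_right)
    hAZ (X ∩ Z') (Y ∩ Z') (fun x hx => ⟨hx.2, hX hx.1⟩) (fun y hy => ⟨hy.2, by
      have := hY y hy.1
      rw [mem_ball_iff]; omega⟩)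
  have hopen : ∀ ω : Config G, ∀ t ∈ Z', ∀ z, Joined (openGraph G ω) (Z \ H) t z →
      Joined (openGraph G ω) Z' t z := fun ω t ht z h =>
    (h.inter_of_closed ht fun a ha b hb hab => hclosed a ha b hb (openGraph_le ω hab)).mono
      Set.inter_subset_right
  have hX' : prob G p (connIn G X (sphere G v (2 * m)) (Z \ H)) ≤
      prob G p (connIn G (X ∩ Z') (sphere G v (2 * m)) Z') := by
    refine prob_mono ?_
    rintro ω ⟨x, hx, t, ht, h⟩
    have h' := hopen ω t (hAZ (hS ht)) x (Joined.symm h)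
    exact ⟨x, ⟨hx, h'.right_mem⟩, t, ht, h'.symm⟩
  have hY' : prob G p (connIn G Y (sphere G v (2 * m)) Z) ≤
      prob G p (connIn G (Y ∩ Z') (sphere G v (2 * m)) Z') := by
    refine prob_mono ?_
    rintro ω ⟨y, hy, t, ht, h⟩
    have hy4 := hY y hy
    -- The path from `Y` is cut on entering `B(v, 2m)`, before it can meet `H`; thus its factor may
    -- be taken in all of `Z`.
    obtain ⟨u, t', h1, h2, h3, h4⟩ := Joined.first_hit (T := ball G v (2 * m)) h
      (by rw [mem_ball_iff]; omega) (sphere_subset_ball le_rfl ht)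
    have h5 : ¬ G.dist v u ≤ 2 * m := h1.right_mem.2
    have h6 : G.dist v t' ≤ 2 * m := h3
    have h7 := dist_le_succ (v := v) hconn (openGraph_le ω h2.symm)
    have ht' : t' ∈ sphere G v (2 * m) := by rw [mem_sphere_iff]; omega
    have h8 : Joined (openGraph G ω) (Z \ H) t' y := by
      refine Joined.cons h2.symm ⟨h4.left_mem, fun h => ?_⟩ (h1.symm.mono ?_)
      · have : G.dist v t' ≤ K := hH h
        omega
      · exact Set.sdiff_subset_sdiff_right (hH.trans (ball_mono (by omega)))
    have h' := hopen ω t' (hAZ (hS ht')) y h8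
    exact ⟨y, ⟨hy, h'.right_mem⟩, t', ht', h'.symm⟩
  calc _ ≤ c * prob G p (connIn G (X ∩ Z') (sphere G v (2 * m)) Z') *
        prob G p (connIn G (Y ∩ Z') (sphere G v (2 * m)) Z') := by
        have n1 : 0 ≤ prob G p (connIn G Y (sphere G v (2 * m)) Z) := prob_nonneg
        have n2 : 0 ≤ prob G p (connIn G (X ∩ Z') (sphere G v (2 * m)) Z') := prob_nonneg
        gcongr
    _ ≤ _ := hq
    _ ≤ _ := prob_mono (connIn_mono Set.inter_subset_left Set.inter_subset_left hsub)

end OneEnded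

/-! ### Two distinct crossing clusters are negligible -/

/-- Two distinct open clusters of the annulus between `B(v, N)` and `S(v, L)` cross it. -/
def twoCrossings {V : Type*} (G : SimpleGraph V) (v : V) (N L : ℕ) : Set (Config G) :=
  {ω | ∃ x ∈ sphere G v (N + 1), ∃ x' ∈ sphere G v (N + 1),
    (∃ t ∈ sphere G v L, Joined (openGraph G ω) (ball G v L \ ball G v N) x t) ∧
    (∃ t ∈ sphere G v L, Joined (openGraph G ω) (ball G v L \ ball G v N) x' t) ∧
    ¬ Joined (openGraph G ω) (ball G v L \ ball G v N) x x'}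

section TwoCrossings

variable {V : Type*} {G : SimpleGraph V} {v w : V} {p : unitInterval} {c ε : ℝ} {N L m : ℕ}

lemma depOn_twoCrossings : DepOn (twoCrossings G v N L) (edgesIn G (ball G v L)) := by
  have hsub : edgesIn G (ball G v L \ ball G v N) ⊆ edgesIn G (ball G v L) :=
    edgesIn_mono Set.sdiff_subset
  rintro ω ω' hω ⟨x, hx, x', hx', ⟨t, ht, h1⟩, ⟨t', ht', h2⟩, h3⟩
  refine ⟨x, hx, x', hx', ⟨t, ht, joined_congr (fun e he => hω e (hsub he)) h1⟩,
    ⟨t', ht', joined_congr (fun e he => hω e (hsub he)) h2⟩, fun h => h3 ?_⟩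
  exact joined_congr (fun e he => (hω e (hsub he)).symm) h

/-- Summing `prob_disjoint_clusters_le` over pairs in `S(v, N + 1)` and moving the starting points
to `w` by finite energy gives `C ^ 2` times the squared probability of `reach G v w L`, with `C`
independent of `L`. One of the two factors tends to `0`. -/
lemma eventually_prob_twoCrossings_lt [Infinite V] (hconn : G.Connected) (hdeg : BoundedDegree G)
    (hp : 0 < p) (h0 : ∀ x, prob G p (clusterInfinite G x) = 0) (hw : G.dist v w ≤ N)
    (hε : 0 < ε) :
    ∀ᶠ L in atTop, prob G p (twoCrossings G v N L) < ε * prob G p (reach G v w L) := by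
  have hfin : (sphere G v (N + 1)).Finite :=
    (ball_finite hconn hdeg v (N + 1)).subset (sphere_subset_ball le_rfl)
  set F := hfin.toFinset
  have hk : ∀ x, ∃ k : ℕ, x ∈ F → ∀ L, N + 1 ≤ L →
      (p : ℝ) ^ k * prob G p (reach G v x L) ≤ prob G p (reach G v w L) := by
    intro x
    by_cases hx : x ∈ F
    · have hx' : G.dist v x = N + 1 := by simpa [F, mem_sphere_iff] using hx
      have hj : Joined G (ball G v (N + 1)) w x :=
        ((joined_ball hconn v w).mono (ball_mono (by omega))).symm.trans
          ((joined_ball hconn v x).mono (ball_mono (by omega)))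
      obtain ⟨k, hk⟩ := exists_pow_mul_prob_connIn_le (ball_finite hconn hdeg v (N + 1)) hj
      exact ⟨k, fun _ L hL => hk _ (ball_finite hconn hdeg v L) (ball_mono hL) _ p⟩
    · exact ⟨0, fun h => absurd h hx⟩
  choose k hk using hk
  have hp' : (0 : ℝ) < p := by exact_mod_cast hp
  set C : ℝ := ∑ x ∈ F, ((p : ℝ) ^ k x)⁻¹
  have hlim : Tendsto (fun L => C ^ 2 * prob G p (reach G v w L)) atTop (𝓝 0) := by
    simpa [h0 w] using (tendsto_prob_reach hconn hdeg v w p).const_mul (C ^ 2)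
  filter_upwards [hlim.eventually_lt_const hε, eventually_ge_atTop (N + 1)] with L hL hNL
  have hpos : 0 < prob G p (reach G v w L) := prob_reach_pos hconn hdeg hp (by omega)
  have hsum : ∑ x ∈ F, prob G p (reach G v x L) ≤ C * prob G p (reach G v w L) := by
    rw [Finset.sum_mul]
    refine Finset.sum_le_sum fun x hx => ?_
    rw [inv_mul_eq_div, le_div_iff₀ (pow_pos hp' _), mul_comm]
    exact hk x hx L hNL
  have hA : ball G v L \ ball G v N ⊆ ball G v L := Set.sdiff_subset
  have hbound : prob G p (twoCrossings G v N L) ≤ (∑ x ∈ F, prob G p (reach G v x L)) ^ 2 := by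
    have hsub : twoCrossings G v N L ⊆ {ω | ∃ q ∈ F ×ˢ F, ω ∈ {ω : Config G |
        (∃ t ∈ sphere G v L, Joined (openGraph G ω) (ball G v L \ ball G v N) q.1 t) ∧
        (∃ t ∈ sphere G v L, Joined (openGraph G ω) (ball G v L \ ball G v N) q.2 t) ∧
        ¬ Joined (openGraph G ω) (ball G v L \ ball G v N) q.1 q.2}} := by
      rintro ω ⟨x, hx, x', hx', h⟩
      exact ⟨(x, x'), by simp [F, hx, hx'], h⟩
    refine (prob_mono hsub).trans ((prob_iUnion_le _ _).trans ?_)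
    rw [sq, Finset.sum_mul_sum, ← Finset.sum_product']
    refine Finset.sum_le_sum fun q _ => ?_
    refine (prob_disjoint_clusters_le hconn hdeg hA q.1 q.2).trans ?_
    exact mul_le_mul (prob_mono (connIn_mono subset_rfl subset_rfl hA))
      (prob_mono (connIn_mono subset_rfl subset_rfl hA)) prob_nonneg prob_nonneg
  calc prob G p (twoCrossings G v N L) ≤ (∑ x ∈ F, prob G p (reach G v x L)) ^ 2 := hbound
    _ ≤ (C * prob G p (reach G v w L)) ^ 2 :=
        pow_le_pow_left₀ (Finset.sum_nonneg fun _ _ => prob_nonneg) hsum 2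
    _ = (C ^ 2 * prob G p (reach G v w L)) * prob G p (reach G v w L) := by ring
    _ < _ := mul_lt_mul_of_pos_right hL hpos

end TwoCrossings

/-! ### Decomposition of a connection through a crossing cluster -/

/-- A walk from a point of `T` either stays in `T` or has a first exit from `T`. -/
lemma Joined.inter_or_exit {V : Type*} {H : SimpleGraph V} {Z T : Set V} {x y : V}
    (h : Joined H Z x y) (hx : x ∈ T) :
    Joined H (Z ∩ T) x y ∨ ∃ a b, Joined H (Z ∩ T) x a ∧ H.Adj a b ∧ b ∈ Z ∧ b ∉ T := by
  by_cases hy : y ∈ T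
  · by_cases hc : ∃ a b, Joined H (Z ∩ T) x a ∧ H.Adj a b ∧ b ∈ Z ∧ b ∉ T
    · exact Or.inr hc
    left
    push Not at hc
    exact (h.inter_of_closed (T := {z | Joined H (Z ∩ T) x z}) (Joined.refl ⟨h.left_mem, hx⟩)
      fun a ha b hb hab => ha.2.concat hab ⟨hb, hc a b ha.2 hab hb⟩).right_mem.2
  · right
    obtain ⟨u, t, h1, h2, h3, h4⟩ := h.first_hit (T := Tᶜ) (by simpa using hx) hy
    rw [sdiff_compl] at h1
    exact ⟨u, t, h1, h2, h4.left_mem, h3⟩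

section Crossing

variable {V : Type*} {G : SimpleGraph V} {v w : V} {p : unitInterval} {N L K : ℕ}
  {d y x Y Z : Set V} {ω : Config G}

/-- `d` is an open cluster of the annulus between `B(v, N)` and `S(v, K)`; the sets of vertices
of `B(v, N)` and outside `B(v, K)` which are joined to `d` by an open edge are `y` and `x`. -/
def clusterEvent (G : SimpleGraph V) (v : V) (N K : ℕ) (d y x : Set V) : Set (Config G) :=
  isCluster G (ball G v K \ ball G v N) d ∩
    {ω | {u | u ∈ ball G v N ∧ ∃ b ∈ d, (openGraph G ω).Adj b u} = y ∧
      {u | u ∉ ball G v K ∧ ∃ b ∈ d, (openGraph G ω).Adj b u} = x}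

/-- The event that `w` is joined to `Y` in `Z` through the crossing cluster `d`. -/
def throughCluster (G : SimpleGraph V) (v w : V) (N L K : ℕ) (Y Z d y x : Set V) :
    Set (Config G) :=
  clusterEvent G v N K d y x ∩
    (connIn G {w} y (ball G v L \ d) ∩ connIn G x Y (Z \ (ball G v L ∪ d)))

lemma depOn_clusterEvent : DepOn (clusterEvent G v N K d y x) (edgesAt G d) := by
  refine depOn_isCluster.inter_same ?_
  intro ω ω' hω h
  have hadj : ∀ a ∈ d, ∀ b, ((openGraph G ω).Adj a b ↔ (openGraph G ω').Adj a b) := by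
    intro a ha b
    have : ∀ e : G.edgeSet, e.1 = s(a, b) → ω e = ω' e :=
      fun e he => hω e ⟨a, by simp [he], ha⟩
    exact ⟨openGraph_adj_congr this, openGraph_adj_congr fun e he => (this e he).symm⟩
  have h1 : ∀ u, (∃ b ∈ d, (openGraph G ω).Adj b u) ↔ ∃ b ∈ d, (openGraph G ω').Adj b u :=
    fun u => exists_congr fun b => and_congr_right fun hb => hadj b hb u
  simpa only [Set.mem_ofPred_eq, h1] using h

lemma exists_mem_sphere_of_adj (hconn : G.Connected) {a b : V} (hab : G.Adj a b)
    (ha : a ∈ ball G v N) (hb : b ∉ ball G v N) : a ∈ sphere G v N ∧ b ∈ sphere G v (N + 1) := by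
  have h1 : G.dist v a ≤ N := ha
  have h2 : ¬ G.dist v b ≤ N := hb
  have := dist_le_succ (v := v) hconn hab
  rw [mem_sphere_iff, mem_sphere_iff]
  omega

lemma throughCluster_subset (hLK : L ≤ K) (hZ : ball G v K ⊆ Z) :
    throughCluster G v w N L K Y Z d y x ⊆ connIn G {w} Y Z := by
  rintro ω ⟨⟨h1, h2, h3⟩, ⟨_, rfl, u, hu, h4⟩, ⟨u', hu', z, hz, h5⟩⟩
  have h4 : Joined (openGraph G ω) (ball G v L \ d) _ u := h4
  have h5 : Joined (openGraph G ω) (Z \ (ball G v L ∪ d)) u' z := h5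
  rw [← h2] at hu
  rw [← h3] at hu'
  obtain ⟨-, b, hb, hbu⟩ := hu
  obtain ⟨-, b', hb', hbu'⟩ := hu'
  have h6 := ((h1 b hb b').2 hb').mono (Set.sdiff_subset.trans hZ)
  refine ⟨_, rfl, z, hz, ((h4.mono ?_).concat hbu.symm h6.left_mem).trans
    (h6.trans (Joined.cons hbu' h6.right_mem (h5.mono Set.sdiff_subset)))⟩
  exact Set.sdiff_subset.trans ((ball_mono hLK).trans hZ)

lemma exists_crossing_of_throughCluster (hconn : G.Connected) (hNL : N < L) (hLK : L ≤ K)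
    (h : ω ∈ throughCluster G v w N L K Y Z d y x) :
    ∃ b ∈ d, b ∈ sphere G v (N + 1) ∧
      ∃ t ∈ sphere G v L, Joined (openGraph G ω) (ball G v L \ ball G v N) b t := by
  obtain ⟨⟨h1, h2, h3⟩, ⟨_, rfl, u, hu, h4⟩, ⟨u', hu', z, hz, h5⟩⟩ := h
  rw [← h2] at hu
  rw [← h3] at hu'
  obtain ⟨huN, b, hb, hbu⟩ := hu
  obtain ⟨huK, b', hb', hbu'⟩ := hu'
  have h6 := (h1 b hb b').2 hb'
  have hbS := (exists_mem_sphere_of_adj hconn (openGraph_le ω hbu.symm) huN h6.left_mem.2).2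
  have hbS' := (exists_mem_sphere_of_adj hconn (openGraph_le ω hbu') h6.right_mem.1 huK).1
  obtain ⟨t, ht, h7, -⟩ := h6.exists_sphere (v := v) (n := L) (openGraph_le ω) hconn
    (by rw [mem_sphere_iff.1 hbS]; omega) (by rw [mem_sphere_iff.1 hbS']; omega)
  exact ⟨b, hb, hbS, t, ht, h7.mono fun z hz => ⟨hz.2, hz.1.2⟩⟩

lemma eq_of_throughCluster {d' y' x' : Set V} (h : ω ∈ throughCluster G v w N L K Y Z d y x)
    (h' : ω ∈ throughCluster G v w N L K Y Z d' y' x') {b b' : V} (hb : b ∈ d) (hb' : b' ∈ d')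
    (hbb : Joined (openGraph G ω) (ball G v K \ ball G v N) b b') :
    d = d' ∧ y = y' ∧ x = x' := by
  obtain rfl := eq_of_mem_isCluster h.1.1 h'.1.1 hb hb' hbb
  exact ⟨rfl, h.1.2.1.symm.trans h'.1.2.1, h.1.2.2.symm.trans h'.1.2.2⟩

lemma eq_of_throughCluster_of_notMem {d' y' x' : Set V} (hconn : G.Connected) (hNL : N < L)
    (hLK : L ≤ K) (h : ω ∈ throughCluster G v w N L K Y Z d y x)
    (h' : ω ∈ throughCluster G v w N L K Y Z d' y' x') (hω : ω ∉ twoCrossings G v N L) :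
    d = d' ∧ y = y' ∧ x = x' := by
  obtain ⟨b, hb, hbS, hbt⟩ := exists_crossing_of_throughCluster hconn hNL hLK h
  obtain ⟨b', hb', hbS', hbt'⟩ := exists_crossing_of_throughCluster hconn hNL hLK h'
  refine eq_of_throughCluster h h' hb hb' (Joined.mono (Z := ball G v L \ ball G v N) ?_
    (Set.sdiff_subset_sdiff_left (ball_mono hLK)))
  by_contra hne
  exact hω ⟨b, hbS, b', hbS', hbt, hbt', hne⟩

/-- Here `d` is the cluster followed after the last exit from `B(v, N)`. If the path from `w` to `d`
left `B(v, L)`, it would make a second crossing from `N` to `L` off `d`. If the path from `d` to `Y`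
came back to `B(v, L)`, it would make a second crossing from `L` to `K`. The intermediate radius `L`
thus separates the inner part from the outer part. -/
lemma exists_throughCluster (hconn : G.Connected) (hw : w ∈ ball G v N) (hNL : N < L)
    (hLK : L < K) (hY : ∀ z ∈ Y, K < G.dist v z) (hω : ω ∈ connIn G {w} Y Z)
    (h₁ : ω ∉ twoCrossings G v N L) (h₂ : ω ∉ twoCrossings G v L K) :
    ∃ d y x, d ⊆ ball G v K \ ball G v N ∧ y ⊆ sphere G v N ∧ x ⊆ sphere G v (K + 1) ∧
      ω ∈ throughCluster G v w N L K Y Z d y x := by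
  obtain ⟨w', hw', z, hz, h⟩ := hω
  have h : Joined (openGraph G ω) Z w z := by
    rw [← Set.mem_singleton_iff.1 hw']; exact h
  have hzK := hY z hz
  obtain ⟨t, u, hwt, htN, htu, huz⟩ := h.last_exit (T := ball G v N) hw
    (by rw [mem_ball_iff]; omega)
  have huN := huz.left_mem.2
  have huS := (exists_mem_sphere_of_adj hconn (openGraph_le ω htu) htN huN).2
  have huS' := mem_sphere_iff.1 huS
  set A := ball G v K \ ball G v N with hA
  obtain ⟨s, hs, hus, -⟩ := huz.exists_sphere (v := v) (n := K) (openGraph_le ω) hconn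
    (by omega) hzK.le
  have hus : Joined (openGraph G ω) A u s := hus.mono fun a ha => ⟨ha.2, ha.1.2⟩
  set d : Set V := {b | Joined (openGraph G ω) A u b} with hd
  have hcl : ω ∈ isCluster G A d := isCluster_setOf_joined A u
  have hdA : d ⊆ A := fun b hb => hb.right_mem
  have hud : u ∈ d := Joined.refl hus.left_mem
  have hstep : ∀ a ∈ A, ∀ b ∈ d, (openGraph G ω).Adj b a → a ∈ d :=
    fun a ha b hb hba => Joined.concat hb hba ha
  refine ⟨d, _, _, hdA, ?_, ?_, ⟨hcl, rfl, rfl⟩, ?_, ?_⟩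
  · rintro a ⟨haN, b, hb, hba⟩
    exact (exists_mem_sphere_of_adj hconn (openGraph_le ω hba.symm) haN (hdA hb).2).1
  · rintro a ⟨haK, b, hb, hba⟩
    exact (exists_mem_sphere_of_adj hconn (openGraph_le ω hba) (hdA hb).1 haK).2
  · have hwd : w ∉ d := fun h => (hdA h).2 hw
    obtain ⟨u₁, b₁, h1, h2, h3, -⟩ := (hwt.concat htu huz.left_mem.1).first_hit hwd hud
    have h4 : Joined (openGraph G ω) ((Z \ d) ∩ ball G v L) w u₁ := by
      rcases h1.inter_or_exit (T := ball G v L) (ball_mono hNL.le hw) with h4 | ⟨a, b, h5, h6, -, h8⟩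
      · exact h4
      exfalso
      have haL := (exists_mem_sphere_of_adj hconn (openGraph_le ω h6) h5.right_mem.2 h8).1
      obtain ⟨t₁, u₂, -, h9, h10, h11⟩ := h5.last_exit (T := ball G v N) hw
        (by rw [mem_ball_iff, mem_sphere_iff.1 haL]; omega)
      have hu₂ := (exists_mem_sphere_of_adj hconn (openGraph_le ω h10) h9 h11.left_mem.2).2
      obtain ⟨s', hs', h12, -⟩ := hus.exists_sphere (v := v) (n := L) (openGraph_le ω) hconn
        (by omega) (by rw [mem_sphere_iff.1 hs]; omega)
      refine h₁ ⟨u, huS, u₂, hu₂, ⟨s', hs', h12.mono fun a ha => ⟨ha.2, ha.1.2⟩⟩,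
        ⟨a, haL, h11.mono fun a ha => ⟨ha.1.2, ha.2⟩⟩, fun hj => h11.left_mem.1.1.2 ?_⟩
      exact hj.mono (Set.sdiff_subset_sdiff_left (ball_mono hLK.le))
    refine ⟨w, rfl, u₁, ⟨?_, b₁, h3, h2.symm⟩, h4.mono fun a ha => ⟨ha.2, ha.1.2⟩⟩
    by_contra hu₁
    exact h1.right_mem.2 (hstep u₁ ⟨ball_mono hLK.le h4.right_mem.2, hu₁⟩ b₁ h3 h2.symm)
  · have hzd : z ∉ d := fun h => by
      have : G.dist v z ≤ K := (hdA h).1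
      omega
    obtain ⟨b₂, u₃, -, h2, h3, h4⟩ := (huz.mono Set.sdiff_subset).last_exit hud hzd
    have h5 : Joined (openGraph G ω) ((Z \ d) ∩ (ball G v L)ᶜ) z u₃ := by
      rcases h4.symm.inter_or_exit (T := (ball G v L)ᶜ)
        (show ¬ G.dist v z ≤ L by omega) with h5 | ⟨a, b, h5, h6, -, h8⟩
      · exact h5
      exfalso
      have haL := (exists_mem_sphere_of_adj hconn (openGraph_le ω h6.symm) (not_not.1 h8)
        h5.right_mem.2).2
      obtain ⟨s', hs', h9, -⟩ := h5.symm.exists_sphere (v := v) (n := K) (openGraph_le ω) hconn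
        (by rw [mem_sphere_iff.1 haL]; omega) hzK.le
      obtain ⟨t', u₄, -, h10, h11, h12⟩ := hus.last_exit (T := ball G v L)
        (by rw [mem_ball_iff]; omega) (by rw [mem_ball_iff, mem_sphere_iff.1 hs]; omega)
      have hu₄ := (exists_mem_sphere_of_adj hconn (openGraph_le ω h11) h10 h12.left_mem.2).2
      refine h₂ ⟨u₄, hu₄, a, haL, ⟨s, hs, h12.mono fun c hc => ⟨hc.1.1, hc.2⟩⟩,
        ⟨s', hs', h9.mono fun c hc => ⟨hc.2, hc.1.2⟩⟩, fun hj => h5.right_mem.1.2 ?_⟩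
      exact (hus.trans (h12.mono Set.sdiff_subset).symm).trans
        (hj.mono (Set.sdiff_subset_sdiff_right (ball_mono hNL.le)))
    refine ⟨u₃, ⟨?_, b₂, h2, h3⟩, z, hz, h5.symm.mono ?_⟩
    · intro hu₃
      exact h4.left_mem.2 (hstep u₃ ⟨hu₃, fun h => h5.right_mem.2 (ball_mono hNL.le h)⟩ b₂ h2 h3)
    · exact fun c hc => ⟨hc.1.1, fun h => h.elim hc.2 hc.1.2⟩

/-- The three factors read disjoint sets of edges: those touching `d`, those within `B(v, L) \ d`,
and those within `Z \ (B(v, L) ∪ d)`. -/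
lemma prob_inter_throughCluster (hconn : G.Connected) (hdeg : BoundedDegree G)
    {E : Set (Config G)} (hE : DepOn E (edgesIn G (ball G v N))) (hNL : N ≤ L)
    (hd : d ⊆ ball G v K \ ball G v N) (hZ : Z.Finite) :
    prob G p (E ∩ throughCluster G v w N L K Y Z d y x) =
      prob G p (clusterEvent G v N K d y x) *
        prob G p (E ∩ connIn G {w} y (ball G v L \ d)) *
        prob G p (connIn G x Y (Z \ (ball G v L ∪ d))) := by
  have hL : (ball G v L).Finite := ball_finite hconn hdeg v L
  have hE' : DepOn E (edgesIn G (ball G v L \ d)) := by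
    refine hE.mono (edgesIn_mono fun a ha => ⟨ball_mono hNL ha, fun h => (hd h).2 ha⟩)
  have h1 : DepOn (E ∩ connIn G {w} y (ball G v L \ d)) (edgesIn G (ball G v L \ d)) :=
    hE'.inter_same depOn_connIn
  have h2 := depOn_clusterEvent (G := G) (v := v) (N := N) (K := K) (d := d) (y := y) (x := x)
  have h3 : DepOn (connIn G x Y (Z \ (ball G v L ∪ d))) _ := depOn_connIn
  have f1 := edgesIn_finite (G := G) (hL.subset (Set.sdiff_subset (t := d)))
  have f2 : (edgesAt G d).Finite := (edgesIn_finite (ball_finite hconn hdeg v (K + 1))).subset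
    (edgesAt_subset hconn (hd.trans Set.sdiff_subset))
  have f3 := edgesIn_finite (G := G) (hZ.subset (Set.sdiff_subset (t := ball G v L ∪ d)))
  have e : E ∩ throughCluster G v w N L K Y Z d y x =
      (clusterEvent G v N K d y x ∩ (E ∩ connIn G {w} y (ball G v L \ d))) ∩
        connIn G x Y (Z \ (ball G v L ∪ d)) := by
    ext ω
    simp only [throughCluster, Set.mem_inter_iff]
    tauto
  rw [e, (h2.inter h1).prob_inter h3 (f2.union f1) f3, h2.prob_inter h1 f2 f1]
  · exact disjoint_edgesAt_edgesIn Set.disjoint_sdiff_right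
  · rw [Set.disjoint_union_left]
    constructor
    · exact disjoint_edgesAt_edgesIn (Set.disjoint_left.2 fun a ha h => h.2 (Or.inr ha))
    · exact disjoint_edgesIn (Set.disjoint_left.2 fun a ha h => h.2 (Or.inl ha.1))

end Crossing

/-! ### Contraction of weighted ratios -/

section Contraction

variable {ι : Type*} {T : Finset ι} {k e i h : ι → ℝ} {lo hi c : ℝ}

/-- The average `r` for the reference weights `h` is the point towards which all other averages will
be pulled. If the denominator vanishes, so does the numerator, and `lo` serves. -/
lemma exists_weighted_ratio (hk : ∀ t ∈ T, 0 ≤ k t) (hh : ∀ t ∈ T, 0 ≤ h t) (hi0 : ∀ t ∈ T, 0 ≤ i t)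
    (hlh : lo ≤ hi) (hlo : ∀ t ∈ T, lo * i t ≤ e t) (hhi : ∀ t ∈ T, e t ≤ hi * i t) :
    ∃ r, lo ≤ r ∧ r ≤ hi ∧ ∑ t ∈ T, k t * e t * h t = r * ∑ t ∈ T, k t * i t * h t := by
  have h1 : lo * ∑ t ∈ T, k t * i t * h t ≤ ∑ t ∈ T, k t * e t * h t := by
    rw [Finset.mul_sum]
    refine Finset.sum_le_sum fun t ht => ?_
    have := mul_le_mul_of_nonneg_left (hlo t ht) (mul_nonneg (hk t ht) (hh t ht))
    linarith
  have h2 : ∑ t ∈ T, k t * e t * h t ≤ hi * ∑ t ∈ T, k t * i t * h t := by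
    rw [Finset.mul_sum]
    refine Finset.sum_le_sum fun t ht => ?_
    have := mul_le_mul_of_nonneg_left (hhi t ht) (mul_nonneg (hk t ht) (hh t ht))
    linarith
  have h3 : 0 ≤ ∑ t ∈ T, k t * i t * h t :=
    Finset.sum_nonneg fun t ht => mul_nonneg (mul_nonneg (hk t ht) (hi0 t ht)) (hh t ht)
  rcases h3.eq_or_lt with h4 | h4
  · refine ⟨lo, le_rfl, hlh, ?_⟩
    rw [← h4] at h1 h2 ⊢
    linarith
  · refine ⟨(∑ t ∈ T, k t * e t * h t) / ∑ t ∈ T, k t * i t * h t, ?_, ?_, ?_⟩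
    · rwa [le_div_iff₀ h4]
    · rwa [div_le_iff₀ h4]
    · rw [div_mul_cancel₀ _ h4.ne']

/-- If the weights `j` are comparable to fixed weights `h`, then the `j`-average of ratios
`e / i` in `[lo, hi]` is closer to the `h`-average `r` than to the endpoints. -/
lemma weighted_ratio_bounds {r q : ℝ} {j : ι → ℝ} (hk : ∀ t ∈ T, 0 ≤ k t)
    (hi0 : ∀ t ∈ T, 0 ≤ i t) (hc : 0 ≤ c) (hr : lo ≤ r) (hr' : r ≤ hi)
    (hlo : ∀ t ∈ T, lo * i t ≤ e t) (hhi : ∀ t ∈ T, e t ≤ hi * i t)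
    (hsum : ∑ t ∈ T, k t * e t * h t = r * ∑ t ∈ T, k t * i t * h t)
    (hj : ∀ t ∈ T, c * h t * q ≤ j t) (hj' : ∀ t ∈ T, j t ≤ h t * q) :
    (lo + c * (r - lo)) * ∑ t ∈ T, k t * i t * j t ≤ ∑ t ∈ T, k t * e t * j t ∧
    ∑ t ∈ T, k t * e t * j t ≤ (hi - c * (hi - r)) * ∑ t ∈ T, k t * i t * j t := by
  -- The lower bound on `j` replaces `j` by `c * q * h` in the nonnegative excess over `lo` (or
  -- deficit from `hi`), whose `h`-sum is known through `r`; `h0` then returns from `h` to `j`.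
  have h0 : ∑ t ∈ T, k t * i t * j t ≤ q * ∑ t ∈ T, k t * i t * h t := by
    rw [Finset.mul_sum]
    refine Finset.sum_le_sum fun t ht => ?_
    have := mul_le_mul_of_nonneg_left (hj' t ht) (mul_nonneg (hk t ht) (hi0 t ht))
    linarith
  constructor
  · have h1 : ∑ t ∈ T, c * q * (k t * e t * h t - lo * (k t * i t * h t)) ≤
        ∑ t ∈ T, (k t * e t * j t - lo * (k t * i t * j t)) := by
      refine Finset.sum_le_sum fun t ht => ?_
      have := mul_le_mul_of_nonneg_left (hj t ht)
        (mul_nonneg (hk t ht) (sub_nonneg.2 (hlo t ht)))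
      linarith
    rw [← Finset.mul_sum, Finset.sum_sub_distrib, Finset.sum_sub_distrib, ← Finset.mul_sum,
      ← Finset.mul_sum, hsum] at h1
    have h2 := mul_le_mul_of_nonneg_left h0 (mul_nonneg hc (sub_nonneg.2 hr))
    linarith
  · have h1 : ∑ t ∈ T, c * q * (hi * (k t * i t * h t) - k t * e t * h t) ≤
        ∑ t ∈ T, (hi * (k t * i t * j t) - k t * e t * j t) := by
      refine Finset.sum_le_sum fun t ht => ?_
      have := mul_le_mul_of_nonneg_left (hj t ht)
        (mul_nonneg (hk t ht) (sub_nonneg.2 (hhi t ht)))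
      linarith
    rw [← Finset.mul_sum, Finset.sum_sub_distrib, Finset.sum_sub_distrib, ← Finset.mul_sum,
      ← Finset.mul_sum, hsum] at h1
    have h2 := mul_le_mul_of_nonneg_left h0 (mul_nonneg hc (sub_nonneg.2 hr'))
    linarith

end Contraction

/-! ### One contraction step -/

/-- The conditional probabilities of `E` given that `w` is joined to a set outside `B(v, N)` in a
region containing `B(v, N)` all lie in `[lo, hi]`. -/
def RatioBounds {V : Type*} (G : SimpleGraph V) (v w : V) (p : unitInterval) (E : Set (Config G))
    (N : ℕ) (lo hi : ℝ) : Prop :=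
  ∀ Z : Set V, Z.Finite → ball G v N ⊆ Z → ∀ Y : Set V, (∀ y ∈ Y, N ≤ G.dist v y) →
    lo * prob G p (connIn G {w} Y Z) ≤ prob G p (E ∩ connIn G {w} Y Z) ∧
    prob G p (E ∩ connIn G {w} Y Z) ≤ hi * prob G p (connIn G {w} Y Z)

section Step

variable {V : Type*} {G : SimpleGraph V} {v w : V} {p : unitInterval} {N L K m : ℕ}
  {Y Z : Set V} {E : Set (Config G)} {c η : ℝ}

/-- The crossings are decided inside `B(v, 2m)`, so the connection from there to `Y` splits off;
quasi-multiplicativity with an empty hole reassembles the full connection at the price `1 / c`. -/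
lemma prob_twoCrossings_inter_le (hconn : G.Connected) (hdeg : BoundedDegree G) (hc : 0 < c)
    (hη : 0 ≤ η) (hw : G.dist v w ≤ m) (hqm : HoleMultiplicative G v p c 0 m)
    (hbad : prob G p (twoCrossings G v N (2 * m)) ≤ η * prob G p (reach G v w (2 * m)))
    (hZ : Z.Finite) (hball : ball G v (4 * m) ⊆ Z) (hY : ∀ y ∈ Y, 4 * m < G.dist v y) :
    prob G p (twoCrossings G v N (2 * m) ∩ connIn G {w} Y Z) ≤
      η / c * prob G p (connIn G {w} Y Z) := by
  have h1 := prob_inter_connIn_le (p := p) (X := {w}) (Y := Y) (r := 2 * m) hconn hdeg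
    (depOn_twoCrossings (G := G) (v := v) (N := N))
    (by rintro _ rfl; rw [mem_ball_iff]; omega) (fun y hy => by have := hY y hy; omega) hZ
  have h2 := hqm Z hZ hball ∅ (Set.empty_subset _) {w} (by rintro _ rfl; exact hw) Y hY
  rw [Set.sdiff_empty] at h2
  have h3 : prob G p (reach G v w (2 * m)) ≤
      prob G p (connIn G {w} (sphere G v (2 * m)) Z) :=
    prob_mono (connIn_mono subset_rfl subset_rfl ((ball_mono (by omega)).trans hball))
  have n1 : 0 ≤ prob G p (connIn G Y (sphere G v (2 * m)) Z) := prob_nonneg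
  calc _ ≤ prob G p (twoCrossings G v N (2 * m)) *
        prob G p (connIn G Y (sphere G v (2 * m)) Z) :=
        h1.trans (mul_le_mul_of_nonneg_right (prob_mono Set.inter_subset_left) n1)
    _ ≤ (η * prob G p (connIn G {w} (sphere G v (2 * m)) Z)) *
        prob G p (connIn G Y (sphere G v (2 * m)) Z) :=
        mul_le_mul_of_nonneg_right (hbad.trans (mul_le_mul_of_nonneg_left h3 hη)) n1
    _ = η / c * (c * prob G p (connIn G {w} (sphere G v (2 * m)) Z) *
        prob G p (connIn G Y (sphere G v (2 * m)) Z)) := by field_simp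
    _ ≤ _ := mul_le_mul_of_nonneg_left h2 (by positivity)

lemma finite_clusterIndex (hconn : G.Connected) (hdeg : BoundedDegree G) (v : V) (N K : ℕ) :
    {t : Set V × Set V × Set V | t.1 ⊆ ball G v K \ ball G v N ∧ t.2.1 ⊆ sphere G v N ∧
      t.2.2 ⊆ sphere G v (K + 1)}.Finite := by
  have hb := fun n => ball_finite hconn hdeg v n
  have hs := fun n => (hb n).subset (sphere_subset_ball (G := G) (v := v) (le_refl n))
  refine ((((hb K).subset (Set.sdiff_subset (t := ball G v N))).finite_subsets).prod
    ((hs N).finite_subsets.prod (hs (K + 1)).finite_subsets)).subset ?_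
  rintro ⟨d, y, x⟩ ⟨h1, h2, h3⟩
  exact ⟨h1, h2, h3⟩

lemma measurableSet_throughCluster (hconn : G.Connected) (hdeg : BoundedDegree G) {d y x : Set V}
    (hd : d ⊆ ball G v K \ ball G v N) (hZ : Z.Finite) :
    MeasurableSet (throughCluster G v w N L K Y Z d y x) := by
  refine MeasurableSet.inter (depOn_clusterEvent.measurableSet ?_) (MeasurableSet.inter ?_ ?_)
  · exact (edgesIn_finite (ball_finite hconn hdeg v (K + 1))).subset
      (edgesAt_subset hconn (hd.trans Set.sdiff_subset))
  · exact measurableSet_connIn ((ball_finite hconn hdeg v L).subset Set.sdiff_subset)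
  · exact measurableSet_connIn (hZ.subset Set.sdiff_subset)

/-- One step of the contraction of the conditional probabilities. -/
lemma exists_ratioBounds_step (hconn : G.Connected) (hdeg : BoundedDegree G) {m₁ m₂ M S : ℕ}
    {lo hi η₁ η₂ δ : ℝ}
    (hw : w ∈ ball G v N) (hE : DepOn E (edgesIn G (ball G v N))) (hEm : MeasurableSet E)
    (hc : 0 < c) (hc1 : c ≤ 1) (hlo : 0 ≤ lo) (hlh : lo ≤ hi) (hhi : hi ≤ 1)
    (hη₁ : 0 ≤ η₁) (hη₂ : 0 ≤ η₂)
    (hS : (sphere G v (N + 1)).ncard ≤ S) (hδ : (S + 1) * (η₁ / c) + η₂ / c ≤ δ)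
    (hN : N < m₁) (hm₁ : m₁ < m₂) (hm₂ : 2 * m₂ < M)
    (hqm₁ : HoleMultiplicative G v p c 0 m₁) (hqm₂ : HoleMultiplicative G v p c 0 m₂)
    (hqm : HoleMultiplicative G v p c (2 * m₂) M)
    (hbad₁ : prob G p (twoCrossings G v N (2 * m₁)) ≤ η₁ * prob G p (reach G v w (2 * m₁)))
    (hbad₂ : prob G p (twoCrossings G v (2 * m₁) (2 * m₂)) ≤ η₂ * prob G p (reach G v w (2 * m₂)))
    (hR : RatioBounds G v w p E N lo hi) :
    ∃ lo' hi', 0 ≤ lo' ∧ lo' ≤ hi' ∧ hi' ≤ 1 ∧ hi' - lo' ≤ (1 - c) * (hi - lo) + 4 * δ ∧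
      RatioBounds G v w p E (4 * M + 1) lo' hi' := by
  classical
  set L := 2 * m₁ with hL
  set K := 2 * m₂ with hK
  have hw' : G.dist v w ≤ N := hw
  have hT := finite_clusterIndex hconn hdeg v N K
  set T := hT.toFinset with hTdef
  have hmem : ∀ t, t ∈ T ↔ t.1 ⊆ ball G v K \ ball G v N ∧ t.2.1 ⊆ sphere G v N ∧
      t.2.2 ⊆ sphere G v (K + 1) := by simp [hTdef]
  -- For `t = (d, y, x)`, `k` is the weight of the cluster, `i` and `e` are the inner factors
  -- without and with `E`, and `h` is the outer factor stopped at `S(v, 2M)`, which involves neither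
  -- `Y` nor `Z`.
  let k : Set V × Set V × Set V → ℝ := fun t => prob G p (clusterEvent G v N K t.1 t.2.1 t.2.2)
  let i : Set V × Set V × Set V → ℝ := fun t => prob G p (connIn G {w} t.2.1 (ball G v L \ t.1))
  let e : Set V × Set V × Set V → ℝ := fun t =>
    prob G p (E ∩ connIn G {w} t.2.1 (ball G v L \ t.1))
  let h : Set V × Set V × Set V → ℝ := fun t => prob G p
    (connIn G t.2.2 (sphere G v (2 * M)) (ball G v (2 * M) \ (ball G v L ∪ t.1)))
  have hei : ∀ t ∈ T, lo * i t ≤ e t ∧ e t ≤ hi * i t := by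
    intro t ht
    obtain ⟨h1, h2, -⟩ := (hmem t).1 ht
    refine hR _ ((ball_finite hconn hdeg v L).subset Set.sdiff_subset) ?_ _ ?_
    · exact fun a ha => ⟨ball_mono (by omega) ha, fun h => (h1 h).2 ha⟩
    · exact fun y hy => (mem_sphere_iff.1 (h2 hy)).ge
  obtain ⟨r, hr, hr', hsum⟩ := exists_weighted_ratio (T := T) (k := k) (e := e) (i := i) (h := h)
    (fun _ _ => prob_nonneg) (fun _ _ => prob_nonneg) (fun _ _ => prob_nonneg) hlh
    (fun t ht => (hei t ht).1) (fun t ht => (hei t ht).2)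
  set α := lo + c * (r - lo) with hα
  set β := hi - c * (hi - r) with hβ
  have hδ0 : 0 ≤ δ := le_trans (by positivity) hδ
  have hα0 : 0 ≤ α := by
    have := mul_nonneg hc.le (sub_nonneg.2 hr); linarith
  have hβ1 : β ≤ 1 := by
    have := mul_nonneg hc.le (sub_nonneg.2 hr'); linarith
  have hαβ : α ≤ β := by
    have := mul_nonneg (sub_nonneg.2 hc1) (sub_nonneg.2 hlh)
    rw [hα, hβ]; linarith
  -- The endpoints are fixed before `Z` and `Y`. Each moves by `2 * δ`: one `δ` for replacing the
  -- probability of `E ∩ C` by the sum over clusters, one for `C`.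
  refine ⟨max 0 (α - 2 * δ), min 1 (β + 2 * δ), le_max_left _ _, ?_, min_le_left _ _, ?_, ?_⟩
  · refine max_le (le_min zero_le_one (by linarith)) (le_min (by linarith) (by linarith))
  · have h1 := le_max_right 0 (α - 2 * δ)
    have h2 := min_le_right 1 (β + 2 * δ)
    have h3 : β - α = (1 - c) * (hi - lo) := by rw [hα, hβ]; ring
    linarith
  intro Z hZ hball Y hY
  have hY' : ∀ n, n ≤ 4 * M → ∀ y ∈ Y, n < G.dist v y := fun n hn y hy => by
    have := hY y hy; omega
  have hball' : ∀ n, n ≤ 4 * M → ball G v n ⊆ Z := fun n hn => (ball_mono (by omega)).trans hball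
  set C := connIn G {w} Y Z with hC
  set B₁ := twoCrossings G v N L with hB₁
  set B₂ := twoCrossings G v L K with hB₂
  let Q : Set V × Set V × Set V → Set (Config G) :=
    fun t => throughCluster G v w N L K Y Z t.1 t.2.1 t.2.2
  let j : Set V × Set V × Set V → ℝ := fun t => prob G p (connIn G t.2.2 Y (Z \ (ball G v L ∪ t.1)))
  set q := prob G p (connIn G Y (sphere G v (2 * M)) Z) with hq
  have hb₁ : prob G p (B₁ ∩ C) ≤ η₁ / c * prob G p C :=
    prob_twoCrossings_inter_le hconn hdeg hc hη₁ (by omega) hqm₁ hbad₁ hZ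
      (hball' _ (by omega)) (hY' _ (by omega))
  have hb₂ : prob G p (B₂ ∩ C) ≤ η₂ / c * prob G p C :=
    prob_twoCrossings_inter_le hconn hdeg hc hη₂ (by omega) hqm₂ hbad₂ hZ
      (hball' _ (by omega)) (hY' _ (by omega))
  have hxM : ∀ t ∈ T, ∀ n, K + 1 ≤ n → t.2.2 ⊆ ball G v n := fun t ht n hn =>
    ((hmem t).1 ht).2.2.trans (sphere_subset_ball hn)
  -- The hole `B(v, L) ∪ d` lies in `B(v, 2 * m₂)`, which is what `hqm` allows.
  have hj : ∀ t ∈ T, c * h t * q ≤ j t := by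
    intro t ht
    refine le_trans ?_ (hqm Z hZ (hball' _ le_rfl) (ball G v L ∪ t.1) ?_ t.2.2
      (hxM t ht M (by omega)) Y (hY' _ le_rfl))
    · refine mul_le_mul_of_nonneg_right (mul_le_mul_of_nonneg_left (prob_mono
        (connIn_mono subset_rfl subset_rfl ?_)) hc.le) prob_nonneg
      exact Set.sdiff_subset_sdiff_left (hball' _ (by omega))
    · exact Set.union_subset (ball_mono (by omega)) (((hmem t).1 ht).1.trans Set.sdiff_subset)
  have hj' : ∀ t ∈ T, j t ≤ h t * q := by
    intro t ht
    refine (prob_connIn_le (r := 2 * M) hconn hdeg (hxM t ht _ (by omega)) (hY' _ (by omega))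
      (hZ.subset Set.sdiff_subset)).trans (mul_le_mul (prob_mono
        (connIn_mono subset_rfl subset_rfl ?_)) (prob_mono
        (connIn_mono subset_rfl subset_rfl Set.sdiff_subset)) prob_nonneg prob_nonneg)
    exact fun a ha => ⟨ha.2, ha.1.2⟩
  obtain ⟨hmain1, hmain2⟩ := weighted_ratio_bounds (T := T) (k := k) (e := e) (i := i) (h := h)
    (j := j) (q := q) (fun _ _ => prob_nonneg) (fun _ _ => prob_nonneg) hc.le hr hr'
    (fun t ht => (hei t ht).1) (fun t ht => (hei t ht).2) hsum hj hj'
  have hprodE : ∀ F : Set (Config G), DepOn F (edgesIn G (ball G v N)) → ∀ t ∈ T,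
      prob G p (F ∩ Q t) = k t * prob G p (F ∩ connIn G {w} t.2.1 (ball G v L \ t.1)) * j t :=
    fun F hF t ht => prob_inter_throughCluster hconn hdeg hF (by omega) ((hmem t).1 ht).1 hZ
  have hQm : ∀ t ∈ T, MeasurableSet (Q t) := fun t ht =>
    measurableSet_throughCluster hconn hdeg ((hmem t).1 ht).1 hZ
  have hQC : ∀ t ∈ T, Q t ⊆ C := fun t ht =>
    throughCluster_subset (by omega) (hball' _ (by omega))
  have hB₁m : MeasurableSet B₁ :=
    depOn_twoCrossings.measurableSet (edgesIn_finite (ball_finite hconn hdeg v L))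
  -- Used for `E` and for the whole space. The events `Q t` cover `C` off `B₁ ∪ B₂`, and they are
  -- disjoint off `B₁`.
  have key : ∀ F : Set (Config G), DepOn F (edgesIn G (ball G v N)) → MeasurableSet F →
      prob G p (F ∩ C) ≤
        ∑ t ∈ T, k t * prob G p (F ∩ connIn G {w} t.2.1 (ball G v L \ t.1)) * j t +
          δ * prob G p C ∧
      ∑ t ∈ T, k t * prob G p (F ∩ connIn G {w} t.2.1 (ball G v L \ t.1)) * j t ≤
        prob G p (F ∩ C) + δ * prob G p C := by
    intro F hF hFm
    rw [← Finset.sum_congr rfl (hprodE F hF)]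
    have hC0 : 0 ≤ prob G p C := prob_nonneg
    have hS0 : (0 : ℝ) ≤ S := by positivity
    have hη₁c : 0 ≤ η₁ / c := by positivity
    have hη₂c : 0 ≤ η₂ / c := by positivity
    have hδC := mul_le_mul_of_nonneg_right hδ hC0
    have hSC : 0 ≤ S * (η₁ / c * prob G p C) := by positivity
    constructor
    · have hsub : F ∩ C ⊆ {ω | ∃ t ∈ T, ω ∈ F ∩ Q t} ∪ (B₁ ∩ C ∪ B₂ ∩ C) := by
        rintro ω ⟨hωF, hωC⟩
        by_cases h1 : ω ∈ B₁
        · exact Or.inr (Or.inl ⟨h1, hωC⟩)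
        by_cases h2 : ω ∈ B₂
        · exact Or.inr (Or.inr ⟨h2, hωC⟩)
        obtain ⟨d, y, x, hd, hy, hx, hω⟩ := exists_throughCluster hconn hw (by omega) (by omega)
          (hY' _ (by omega)) hωC h1 h2
        exact Or.inl ⟨(d, y, x), (hmem _).2 ⟨hd, hy, hx⟩, hωF, hω⟩
      have h1 := (prob_mono (p := p) hsub).trans (prob_union_le.trans
        (add_le_add (prob_iUnion_le T fun t => F ∩ Q t) prob_union_le))
      linarith
    · have hsplit : ∀ t ∈ T, prob G p (F ∩ Q t) ≤
          prob G p ((F ∩ Q t) ∩ B₁ᶜ) + prob G p (Q t ∩ B₁) := by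
        intro t _
        refine (prob_mono (B := ((F ∩ Q t) ∩ B₁ᶜ) ∪ (Q t ∩ B₁)) ?_).trans prob_union_le
        intro ω hω
        by_cases h1 : ω ∈ B₁
        · exact Or.inr ⟨hω.2, h1⟩
        · exact Or.inl ⟨hω, h1⟩
      have hgood : ∑ t ∈ T, prob G p ((F ∩ Q t) ∩ B₁ᶜ) ≤ prob G p (F ∩ C) := by
        refine sum_prob_le T _ (fun t ht => (hFm.inter (hQm t ht)).inter hB₁m.compl)
          (fun t ht ω hω => ⟨hω.1.1, hQC t ht hω.1.2⟩) ?_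
        intro t _ t' _ hne
        refine Set.disjoint_left.2 fun ω h1 h2 => hne ?_
        obtain ⟨e1, e2, e3⟩ := eq_of_throughCluster_of_notMem hconn (by omega) (by omega)
          h1.1.2 h2.1.2 h1.2
        exact Prod.ext e1 (Prod.ext e2 e3)
      have hSfin : (sphere G v (N + 1)).Finite :=
        (ball_finite hconn hdeg v (N + 1)).subset (sphere_subset_ball le_rfl)
      -- On `B₁` the events `Q t` may overlap, but every cluster contains a vertex of `S(v, N + 1)`,
      -- and in a given configuration that vertex determines `t`. So at most `S` of them occur
      -- together.
      have hbadsum : ∑ t ∈ T, prob G p (Q t ∩ B₁) ≤ S * prob G p (B₁ ∩ C) := by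
        calc ∑ t ∈ T, prob G p (Q t ∩ B₁)
            ≤ ∑ t ∈ T, ∑ a ∈ hSfin.toFinset with a ∈ t.1, prob G p (Q t ∩ B₁) := by
              refine Finset.sum_le_sum fun t _ => ?_
              rcases (Q t).eq_empty_or_nonempty with h0 | ⟨ω, hω⟩
              · rw [h0]; simp [prob]
              · obtain ⟨b, hb, hbS, -⟩ := exists_crossing_of_throughCluster hconn
                  (by omega) (by omega) hω
                exact Finset.single_le_sum (f := fun _ => prob G p (Q t ∩ B₁))
                  (fun _ _ => prob_nonneg) (Finset.mem_filter.2 ⟨by simpa using hbS, hb⟩)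
          _ = ∑ a ∈ hSfin.toFinset, ∑ t ∈ T with a ∈ t.1, prob G p (Q t ∩ B₁) := by
              simp_rw [Finset.sum_filter]
              exact Finset.sum_comm
          _ ≤ ∑ a ∈ hSfin.toFinset, prob G p (B₁ ∩ C) := by
              refine Finset.sum_le_sum fun a _ => sum_prob_le _ _ ?_ ?_ ?_
              · exact fun t ht => (hQm t (Finset.mem_filter.1 ht).1).inter hB₁m
              · exact fun t ht ω hω => ⟨hω.2, hQC t (Finset.mem_filter.1 ht).1 hω.1⟩
              · intro t ht t' ht' hne
                refine Set.disjoint_left.2 fun ω h1 h2 => hne ?_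
                rw [Finset.mem_filter] at ht ht'
                obtain ⟨e1, e2, e3⟩ := eq_of_throughCluster h1.1 h2.1 ht.2 ht'.2
                  (Joined.refl (((hmem t).1 ht.1).1 ht.2))
                exact Prod.ext e1 (Prod.ext e2 e3)
          _ = (sphere G v (N + 1)).ncard * prob G p (B₁ ∩ C) := by
              rw [Finset.sum_const, nsmul_eq_mul, Set.ncard_eq_toFinset_card _ hSfin]
          _ ≤ S * prob G p (B₁ ∩ C) :=
              mul_le_mul_of_nonneg_right (by exact_mod_cast hS) prob_nonneg
      have h1 := Finset.sum_le_sum hsplit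
      rw [Finset.sum_add_distrib] at h1
      have h2 := mul_le_mul_of_nonneg_left hb₁ hS0
      have h3 : 0 ≤ η₁ / c * prob G p C := by positivity
      have h4 : 0 ≤ η₂ / c * prob G p C := by positivity
      linarith
  obtain ⟨kE1, kE2⟩ := key E hE hEm
  obtain ⟨kU1, kU2⟩ := key Set.univ (fun _ _ _ h => h) MeasurableSet.univ
  simp only [Set.univ_inter] at kU1 kU2
  change prob G p (E ∩ C) ≤ ∑ t ∈ T, k t * e t * j t + δ * prob G p C at kE1
  change ∑ t ∈ T, k t * e t * j t ≤ prob G p (E ∩ C) + δ * prob G p C at kE2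
  change prob G p C ≤ ∑ t ∈ T, k t * i t * j t + δ * prob G p C at kU1
  change ∑ t ∈ T, k t * i t * j t ≤ prob G p C + δ * prob G p C at kU2
  have hC0 : 0 ≤ prob G p C := prob_nonneg
  have hEC : prob G p (E ∩ C) ≤ prob G p C := prob_mono Set.inter_subset_right
  have hEC0 : 0 ≤ prob G p (E ∩ C) := prob_nonneg
  have hβ0 : 0 ≤ β := hα0.trans hαβ
  have hα1 : α ≤ 1 := hαβ.trans hβ1
  have hδC : 0 ≤ δ * prob G p C := mul_nonneg hδ0 hC0
  constructor
  · rcases max_cases 0 (α - 2 * δ) with ⟨h1, -⟩ | ⟨h1, -⟩ <;> rw [h1]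
    · simpa using hEC0
    · have h2 := mul_le_mul_of_nonneg_left kU1 hα0
      have h3 := mul_le_mul_of_nonneg_right hα1 hδC
      linarith
  · rcases min_cases 1 (β + 2 * δ) with ⟨h1, -⟩ | ⟨h1, -⟩ <;> rw [h1]
    · simpa using hEC
    · have h2 := mul_le_mul_of_nonneg_left kU2 hβ0
      have h3 := mul_le_mul_of_nonneg_right hβ1 hδC
      linarith

end Step

/-! ### Iteration of the step, and the limits without percolation -/

lemma QuasiMultiplicative.mono {V : Type*} {G : SimpleGraph V} {v : V} {p : unitInterval}
    {c c' : ℝ} (h : QuasiMultiplicative G v p c) (hc : c' ≤ c) : QuasiMultiplicative G v p c' := by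
  intro m hm Z hZ hconn hann X Y hX hY
  refine le_trans ?_ (h m hm Z hZ hconn hann X Y hX hY)
  rw [mul_assoc, mul_assoc]
  exact mul_le_mul_of_nonneg_right hc (mul_nonneg prob_nonneg prob_nonneg)

section Asymptotics

variable {V : Type*} {G : SimpleGraph V} {v w : V} {p₀ : unitInterval} {P : Set unitInterval}
  {E : Set (Config G)} {c : ℝ}

/-- At some scale, for `p ∈ P` close to `p₀`, the conditional probabilities of `E` oscillate by at
most `θ`. -/
def OscillationLE (G : SimpleGraph V) (v w : V) (E : Set (Config G)) (p₀ : unitInterval)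
    (P : Set unitInterval) (θ : ℝ) : Prop :=
  ∃ N, w ∈ ball G v N ∧ DepOn E (edgesIn G (ball G v N)) ∧ ∀ᶠ p in 𝓝[P] p₀, ∃ lo hi,
    0 ≤ lo ∧ lo ≤ hi ∧ hi ≤ 1 ∧ hi - lo ≤ θ ∧ RatioBounds G v w p E N lo hi

lemma continuous_prob_reach (hconn : G.Connected) (hdeg : BoundedDegree G) (n : ℕ) :
    Continuous fun p : unitInterval => prob G p (reach G v w n) :=
  depOn_connIn.continuous_prob (edgesIn_finite (ball_finite hconn hdeg v n))

lemma exists_scale [Infinite V] (hconn : G.Connected) (hdeg : BoundedDegree G) (hp₀ : 0 < p₀)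
    (h0 : ∀ x, prob G p₀ (clusterInfinite G x) = 0) {N : ℕ} (hw : w ∈ ball G v N) {η : ℝ}
    (hη : 0 < η) (M : ℕ) : ∃ m, M < m ∧ ∀ᶠ p in 𝓝 p₀,
      prob G p (twoCrossings G v N (2 * m)) ≤ η * prob G p (reach G v w (2 * m)) := by
  obtain ⟨L₀, hL₀⟩ :=
    eventually_atTop.1 (eventually_prob_twoCrossings_lt hconn hdeg hp₀ h0 hw hη)
  refine ⟨max L₀ (M + 1), by omega, ?_⟩
  have h1 := hL₀ (2 * max L₀ (M + 1)) (by omega)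
  have c1 : Continuous fun p : unitInterval =>
      prob G p (twoCrossings G v N (2 * max L₀ (M + 1))) :=
    depOn_twoCrossings.continuous_prob (edgesIn_finite (ball_finite hconn hdeg v _))
  have c2 : Continuous fun p : unitInterval =>
      η * prob G p (reach G v w (2 * max L₀ (M + 1))) :=
    continuous_const.mul (continuous_prob_reach hconn hdeg _)
  filter_upwards [c1.continuousAt.eventually_lt c2.continuousAt h1] with p hp using hp.le

/-- One-endedness, obtained at `p₀`, is a property of the graph. The scales `m₁` and `m₂` are chosen
at `p₀` through strict inequalities between continuous functions of `p`, so they serve all `p ∈ P`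
near `p₀`. -/
lemma OscillationLE.step [Infinite V] (hconn : G.Connected) (hdeg : BoundedDegree G)
    (hp₀ : 0 < p₀) (h0 : ∀ x, prob G p₀ (clusterInfinite G x) = 0) (hc : 0 < c) (hc1 : c ≤ 1)
    (hqm₀ : QuasiMultiplicative G v p₀ c) (hqm : ∀ p ∈ P, QuasiMultiplicative G v p c)
    {θ ε : ℝ} (hε : 0 < ε) (h : OscillationLE G v w E p₀ P θ) :
    OscillationLE G v w E p₀ P ((1 - c) * θ + ε) := by
  obtain ⟨N, hw, hE, hev⟩ := h
  have hone := oneEndedAt hconn hdeg hp₀ h0 hc hqm₀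
  have hEm : MeasurableSet E := hE.measurableSet (edgesIn_finite (ball_finite hconn hdeg v N))
  obtain ⟨M₀, -, hM₀⟩ := exists_holeMultiplicative hconn hdeg hone 0
  set S := (sphere G v (N + 1)).ncard
  have hS : (0 : ℝ) < S + 1 := by positivity
  -- The two tolerances contribute `ε / 8` each, so `δ = ε / 4`, and the step loses `4 * δ = ε`.
  obtain ⟨m₁, hm₁, hb₁⟩ := exists_scale (η := c * (ε / 8) / (S + 1)) hconn hdeg hp₀ h0 hw
    (by positivity) (N + M₀)
  obtain ⟨m₂, hm₂, hb₂⟩ := exists_scale (N := 2 * m₁) (η := c * (ε / 8)) hconn hdeg hp₀ h0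
    (ball_mono (by omega) hw) (by positivity) m₁
  obtain ⟨M, hM, hqM⟩ := exists_holeMultiplicative hconn hdeg hone (2 * m₂)
  refine ⟨4 * M + 1, ball_mono (by omega) hw, hE.mono (edgesIn_mono (ball_mono (by omega))), ?_⟩
  filter_upwards [hev, hb₁.filter_mono nhdsWithin_le_nhds, hb₂.filter_mono nhdsWithin_le_nhds,
    self_mem_nhdsWithin] with p ⟨lo, hi, hlo, hlh, hhi, hθ, hR⟩ hp₁ hp₂ hpP
  have hq := hqm p hpP
  obtain ⟨lo', hi', h1, h2, h3, h4, h5⟩ := exists_ratioBounds_step (S := S) (δ := ε / 4) hconn hdeg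
    hw hE hEm hc hc1 hlo hlh hhi (by positivity) (by positivity) le_rfl
    (by field_simp; norm_num) (by omega) hm₂ hM
    (hM₀ m₁ (by omega) p c hc.le hq) (hM₀ m₂ (by omega) p c hc.le hq) (hqM M le_rfl p c hc.le hq)
    hp₁ hp₂ hR
  refine ⟨lo', hi', h1, h2, h3, h4.trans ?_, h5⟩
  have := mul_le_mul_of_nonneg_left hθ (sub_nonneg.2 hc1)
  linarith

lemma OscillationLE.of_depOn {N : ℕ} (hw : w ∈ ball G v N)
    (hE : DepOn E (edgesIn G (ball G v N))) : OscillationLE G v w E p₀ P 1 := by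
  refine ⟨N, hw, hE, Eventually.of_forall fun p => ⟨0, 1, le_rfl, zero_le_one, le_rfl, by simp, ?_⟩⟩
  intro Z _ _ Y _
  rw [zero_mul, one_mul]
  exact ⟨prob_nonneg, prob_mono Set.inter_subset_right⟩

lemma oscillationLE [Infinite V] (hconn : G.Connected) (hdeg : BoundedDegree G)
    (hp₀ : 0 < p₀) (h0 : ∀ x, prob G p₀ (clusterInfinite G x) = 0) (hc : 0 < c) (hc1 : c ≤ 1)
    (hqm₀ : QuasiMultiplicative G v p₀ c) (hqm : ∀ p ∈ P, QuasiMultiplicative G v p c)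
    {N : ℕ} (hw : w ∈ ball G v N) (hE : DepOn E (edgesIn G (ball G v N))) {θ : ℝ} (hθ : 0 < θ) :
    OscillationLE G v w E p₀ P θ := by
  have hpow : ∀ n : ℕ, OscillationLE G v w E p₀ P ((1 - c / 2) ^ n) := by
    intro n
    induction n with
    | zero => simpa using OscillationLE.of_depOn hw hE
    | succ n ih =>
      have hpos : 0 < (1 - c / 2) ^ n := pow_pos (by linarith) n
      -- An error of `c / 2` times the current oscillation weakens the factor `1 - c` to `1 - c /
      -- 2`.
      have := ih.step (ε := c / 2 * (1 - c / 2) ^ n) hconn hdeg hp₀ h0 hc hc1 hqm₀ hqm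
        (by positivity)
      convert this using 1
      ring
  obtain ⟨n, hn⟩ := exists_pow_lt_of_lt_one hθ (show 1 - c / 2 < 1 by linarith)
  obtain ⟨N', h1, h2, h3⟩ := hpow n
  refine ⟨N', h1, h2, h3.mono ?_⟩
  rintro p ⟨lo, hi, a1, a2, a3, a4, a5⟩
  exact ⟨lo, hi, a1, a2, a3, a4.trans hn.le, a5⟩

lemma exists_mem_edgesIn_ball (v : V) (e : G.edgeSet) : ∃ N, e ∈ edgesIn G (ball G v N) := by
  obtain ⟨e, he⟩ := e
  induction e with
  | _ a b =>
    refine ⟨max (G.dist v a) (G.dist v b), fun c hc => ?_⟩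
    rcases Sym2.mem_iff.1 hc with rfl | rfl
    · exact mem_ball_iff.2 (le_max_left _ _)
    · exact mem_ball_iff.2 (le_max_right _ _)

lemma exists_depOn_ball
    (hE : E ∈ measurableCylinders (fun _ : G.edgeSet => Bool)) (v w : V) :
    ∃ N, w ∈ ball G v N ∧ DepOn E (edgesIn G (ball G v N)) := by
  obtain ⟨s, S, -, rfl⟩ := (mem_measurableCylinders E).1 hE
  choose f hf using exists_mem_edgesIn_ball (G := G) v
  have hs : ∃ N, ∀ e ∈ s, e ∈ edgesIn G (ball G v N) :=
    ⟨s.sup f, fun e he => edgesIn_mono (ball_mono (Finset.le_sup he)) (hf e)⟩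
  obtain ⟨N, hN⟩ := hs
  refine ⟨max N (G.dist v w), mem_ball_iff.2 (le_max_right _ _), ?_⟩
  intro ω ω' hω h
  rw [mem_cylinder] at h ⊢
  convert h using 1
  funext e
  exact (hω e (edgesIn_mono (ball_mono (le_max_left _ _)) (hN e e.2))).symm

lemma condProb_eq_div {p : unitInterval} {A : Set (Config G)} (hA : MeasurableSet A) :
    condProb G p E A = prob G p (E ∩ A) / prob G p A := by
  rw [condProb, measureReal_def, cond_apply hA, ENNReal.toReal_mul, ENNReal.toReal_inv,
    Set.inter_comm, prob, prob, measureReal_def, measureReal_def, div_eq_inv_mul]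

lemma condProb_conn_sphere (hconn : G.Connected) (hdeg : BoundedDegree G) (p : unitInterval)
    (w : V) (n : ℕ) : condProb G p E (conn G {w} (sphere G w n)) =
      prob G p (E ∩ reach G w w n) / prob G p (reach G w w n) := by
  rw [conn_sphere_eq_reach hconn, condProb_eq_div (measurableSet_reach hconn hdeg)]

/-- The conditional probabilities given `w ↔ S(w, n)` are Cauchy, uniformly in `p` near `p₀`. -/
lemma exists_abs_condProb_sub_le [Infinite V] (hconn : G.Connected) (hdeg : BoundedDegree G)
    (hp₀ : 0 < p₀) (h0 : ∀ x, prob G p₀ (clusterInfinite G x) = 0) (hc : 0 < c)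
    (hqm₀ : QuasiMultiplicative G v p₀ c) (hqm : ∀ p ∈ P, QuasiMultiplicative G v p c)
    (hE : E ∈ measurableCylinders (fun _ : G.edgeSet => Bool)) (w : V) {θ : ℝ} (hθ : 0 < θ) :
    ∃ n₀, ∀ᶠ p in 𝓝[P] p₀, ∀ n ≥ n₀, ∀ n' ≥ n₀,
      |condProb G p E (conn G {w} (sphere G w n)) -
        condProb G p E (conn G {w} (sphere G w n'))| ≤ θ := by
  obtain ⟨N, hw, hEN⟩ := exists_depOn_ball hE v w
  obtain ⟨N, hw, -, hev⟩ := oscillationLE (c := min c 1) hconn hdeg hp₀ h0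
    (lt_min hc one_pos) (min_le_right _ _) (hqm₀.mono (min_le_left _ _))
    (fun p hp => (hqm p hp).mono (min_le_left _ _)) hw hEN hθ
  have hpos : ∀ᶠ p in 𝓝[P] p₀, 0 < p :=
    (eventually_gt_nhds hp₀).filter_mono nhdsWithin_le_nhds
  -- As `G.dist v w ≤ N`, for `n ≥ 2N` the ball `B(w, n)` contains `B(v, N)`, and `S(w, n)` is at
  -- distance at least `N` from `v`.
  refine ⟨N + N, ?_⟩
  filter_upwards [hev, hpos] with p ⟨lo, hi, _, _, _, hle, hR⟩ hp
  have hwN : G.dist v w ≤ N := hw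
  have key : ∀ n ≥ N + N, lo ≤ condProb G p E (conn G {w} (sphere G w n)) ∧
      condProb G p E (conn G {w} (sphere G w n)) ≤ hi := by
    intro n hn
    rw [condProb_conn_sphere hconn hdeg]
    have h1 : 0 < prob G p (reach G w w n) := prob_reach_pos hconn hdeg hp (by simp)
    have h5 := fun a => hconn.dist_triangle (u := w) (v := v) (w := a)
    rw [SimpleGraph.dist_comm (u := w) (v := v)] at h5
    have h6 : ball G v N ⊆ ball G w n := by
      intro a ha
      have h7 : G.dist v a ≤ N := ha
      have h8 := h5 a
      rw [mem_ball_iff]; omega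
    have h7 : ∀ a ∈ sphere G w n, N ≤ G.dist v a := by
      intro a ha
      have h8 := mem_sphere_iff.1 ha
      have h9 := h5 a
      omega
    obtain ⟨h2, h3⟩ := hR (ball G w n) (ball_finite hconn hdeg w n) h6 (sphere G w n) h7
    exact ⟨(le_div_iff₀ h1).2 h2, (div_le_iff₀ h1).2 h3⟩
  intro n hn n' hn'
  have h1 := key n hn
  have h2 := key n' hn'
  rw [abs_le]
  constructor <;> linarith

lemma exists_tendsto_condProb [Infinite V] (hconn : G.Connected) (hdeg : BoundedDegree G)
    (hp₀ : 0 < p₀) (h0 : ∀ x, prob G p₀ (clusterInfinite G x) = 0) (hc : 0 < c)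
    (hqm₀ : QuasiMultiplicative G v p₀ c)
    (hE : E ∈ measurableCylinders (fun _ : G.edgeSet => Bool)) (w : V) :
    ∃ ℓ : ℝ, Tendsto (fun n => condProb G p₀ E (conn G {w} (sphere G w n))) atTop (𝓝 ℓ) := by
  refine cauchySeq_tendsto_of_complete (Metric.cauchySeq_iff'.2 fun ε hε => ?_)
  obtain ⟨n₀, hn₀⟩ := exists_abs_condProb_sub_le (P := {p₀}) hconn hdeg hp₀ h0 hc hqm₀
    (by rintro _ rfl; exact hqm₀) hE w (half_pos hε)
  have h1 := hn₀.self_of_nhdsWithin rfl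
  refine ⟨n₀, fun n hn => ?_⟩
  rw [Real.dist_eq]
  exact (h1 n hn n₀ le_rfl).trans_lt (half_lt_self hε)

/-- Interchange of limits: one `n₀` approximates the limit in `n` for all `p` near `p_c`, and at
`n₀` the conditional probability is continuous in `p`. For `p > p_c` the limit in `n` is
conditioning on an infinite cluster. -/
lemma tendsto_condProb_clusterInfinite_nhdsGT [Infinite V] (hconn : G.Connected)
    (hdeg : BoundedDegree G) (h0 : ∀ x, prob G (pc G) (clusterInfinite G x) = 0) (hc : 0 < c)
    {δ : ℝ} (hδ : 0 < δ) (hqm : ∀ p : unitInterval, pc G ≤ p → (p : ℝ) ≤ pc G + δ →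
      QuasiMultiplicative G v p c)
    (hE : E ∈ measurableCylinders (fun _ : G.edgeSet => Bool)) (w : V) {ℓ : ℝ}
    (hℓ : Tendsto (fun n => condProb G (pc G) E (conn G {w} (sphere G w n))) atTop (𝓝 ℓ)) :
    Tendsto (fun p => condProb G p E (clusterInfinite G w)) (𝓝[>] (pc G)) (𝓝 ℓ) := by
  have hpc := pc_pos hconn hdeg
  have hqm₀ : QuasiMultiplicative G v (pc G) c := hqm _ le_rfl (by linarith)
  have hEm : MeasurableSet E := .of_mem_measurableCylinders hE
  set P : Set unitInterval := {p | pc G ≤ p ∧ (p : ℝ) ≤ pc G + δ} with hP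
  have hPle : 𝓝[>] (pc G) ≤ 𝓝[P] (pc G) := by
    refine nhdsWithin_le_iff.2 ?_
    have h1 : ∀ᶠ p : unitInterval in 𝓝 (pc G), (p : ℝ) < pc G + δ :=
      continuous_subtype_val.continuousAt.eventually_lt_const (by linarith)
    filter_upwards [self_mem_nhdsWithin, h1.filter_mono nhdsWithin_le_nhds] with p hp h
    exact ⟨le_of_lt hp, h.le⟩
  rw [Metric.tendsto_nhds]
  intro ε hε
  obtain ⟨n₀, hn₀⟩ := exists_abs_condProb_sub_le (P := P) hconn hdeg hpc h0 hc hqm₀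
    (fun p hp => hqm p hp.1 hp.2) hE w (show 0 < ε / 4 by linarith)
  have hlim₀ : |condProb G (pc G) E (conn G {w} (sphere G w n₀)) - ℓ| ≤ ε / 4 := by
    have h1 := hn₀.self_of_nhdsWithin (show pc G ∈ P from ⟨le_rfl, by linarith⟩)
    refine le_of_tendsto ((hℓ.const_sub _).abs) ?_
    filter_upwards [eventually_ge_atTop n₀] with n hn using h1 n₀ le_rfl n hn
  obtain ⟨N, -, hEN⟩ := exists_depOn_ball hE w w
  have hcont : ContinuousAt
      (fun p : unitInterval => condProb G p E (conn G {w} (sphere G w n₀))) (pc G) := by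
    simp_rw [condProb_conn_sphere hconn hdeg]
    refine ContinuousAt.div ?_ (continuous_prob_reach hconn hdeg n₀).continuousAt
      (prob_reach_pos hconn hdeg hpc (by simp)).ne'
    exact ((hEN.inter depOn_connIn).continuous_prob
      ((edgesIn_finite (ball_finite hconn hdeg w N)).union
        (edgesIn_finite (ball_finite hconn hdeg w n₀)))).continuousAt
  have hnear := Metric.tendsto_nhds.1 hcont.tendsto (ε / 4) (by linarith)
  filter_upwards [hPle hn₀, hnear.filter_mono nhdsWithin_le_nhds, self_mem_nhdsWithin]
    with p hp₁ hp₂ hp₃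
  have hpos : 0 < prob G p (clusterInfinite G w) := prob_clusterInfinite_pos hconn hdeg w hp₃
  have hlim : Tendsto (fun n => condProb G p E (conn G {w} (sphere G w n))) atTop
      (𝓝 (condProb G p E (clusterInfinite G w))) := by
    simp_rw [condProb_conn_sphere hconn hdeg]
    rw [condProb_eq_div (measurableSet_clusterInfinite hconn hdeg w)]
    exact (tendsto_prob_inter_reach hconn hdeg hEm w w p).div
      (tendsto_prob_reach hconn hdeg w w p) hpos.ne'
  have h1 : |condProb G p E (conn G {w} (sphere G w n₀)) -
      condProb G p E (clusterInfinite G w)| ≤ ε / 4 := by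
    refine le_of_tendsto ((hlim.const_sub _).abs) ?_
    filter_upwards [eventually_ge_atTop n₀] with n hn using hp₁ n₀ le_rfl n hn
  rw [Real.dist_eq] at hp₂ ⊢
  rw [abs_le] at h1 hlim₀
  rw [abs_lt] at hp₂ ⊢
  constructor <;> linarith

end Asymptotics

/-! ### The case of percolation at `p_c` -/

section Percolating

variable {V : Type*} {G : SimpleGraph V} {w : V} {E : Set (Config G)} {p₀ : unitInterval}

lemma tendsto_condProb_conn_sphere_of_pos (hconn : G.Connected) (hdeg : BoundedDegree G)
    (hE : MeasurableSet E) (h : 0 < prob G p₀ (clusterInfinite G w)) :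
    Tendsto (fun n => condProb G p₀ E (conn G {w} (sphere G w n))) atTop
      (𝓝 (condProb G p₀ E (clusterInfinite G w))) := by
  simp_rw [condProb_conn_sphere hconn hdeg]
  rw [condProb_eq_div (measurableSet_clusterInfinite hconn hdeg w)]
  exact (tendsto_prob_inter_reach hconn hdeg hE w w p₀).div
    (tendsto_prob_reach hconn hdeg w w p₀) h.ne'

/-- Right-continuity: for large `n` the event `reach G w w n` barely exceeds `clusterInfinite G w`
at `p₀`. By monotonicity of the latter and continuity of the former, this persists for `p` slightly
above `p₀`. -/
lemma tendsto_prob_inter_clusterInfinite_nhdsGT (hconn : G.Connected) (hdeg : BoundedDegree G)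
    {N : ℕ} (hE : DepOn E (edgesIn G (ball G w N))) :
    Tendsto (fun p => prob G p (E ∩ clusterInfinite G w)) (𝓝[>] p₀)
      (𝓝 (prob G p₀ (E ∩ clusterInfinite G w))) := by
  rw [Metric.tendsto_nhds]
  intro ε hε
  have hR := (tendsto_prob_reach hconn hdeg w w p₀).eventually_lt_const
    (show prob G p₀ (clusterInfinite G w) < prob G p₀ (clusterInfinite G w) + ε / 4 by linarith)
  obtain ⟨n, hn⟩ := hR.exists
  have c1 := (continuous_prob_reach (v := w) (w := w) hconn hdeg n).tendsto p₀
  have c2 := ((hE.inter (depOn_connIn (X := {w}) (Y := sphere G w n) (Z := ball G w n))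
    ).continuous_prob ((edgesIn_finite (ball_finite hconn hdeg w N)).union
        (edgesIn_finite (ball_finite hconn hdeg w n)))).tendsto p₀
  have e1 := Metric.tendsto_nhds.1 c2 (ε / 4) (by linarith)
  filter_upwards [(c1.eventually_lt_const hn).filter_mono nhdsWithin_le_nhds,
    e1.filter_mono nhdsWithin_le_nhds, self_mem_nhdsWithin] with p h1 h2 h3
  have hsub : clusterInfinite G w ⊆ reach G w w n :=
    clusterInfinite_subset_reach hconn hdeg (by simp)
  have key : ∀ r : unitInterval, prob G r (E ∩ reach G w w n) ≤ prob G r (E ∩ clusterInfinite G w) +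
      (prob G r (reach G w w n) - prob G r (clusterInfinite G w)) := by
    intro r
    have h4 : prob G r (reach G w w n \ clusterInfinite G w) =
        prob G r (reach G w w n) - prob G r (clusterInfinite G w) :=
      measureReal_sdiff hsub (measurableSet_clusterInfinite hconn hdeg w)
    rw [← h4]
    refine (prob_mono ?_).trans prob_union_le
    intro ω hω
    by_cases h : ω ∈ clusterInfinite G w
    · exact Or.inl ⟨hω.1, h⟩
    · exact Or.inr ⟨hω.2, h⟩
  have k1 := key p
  have k2 := key p₀
  have m1 : prob G p (E ∩ clusterInfinite G w) ≤ prob G p (E ∩ reach G w w n) :=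
    prob_mono (Set.inter_subset_inter_right _ hsub)
  have m2 : prob G p₀ (E ∩ clusterInfinite G w) ≤ prob G p₀ (E ∩ reach G w w n) :=
    prob_mono (Set.inter_subset_inter_right _ hsub)
  have m3 : prob G p₀ (clusterInfinite G w) ≤ prob G p (clusterInfinite G w) :=
    prob_clusterInfinite_mono hconn hdeg w (le_of_lt h3)
  change dist (prob G p (E ∩ reach G w w n)) (prob G p₀ (E ∩ reach G w w n)) < ε / 4 at h2
  rw [Real.dist_eq, abs_lt] at h2 ⊢
  constructor <;> linarith

lemma tendsto_condProb_clusterInfinite_of_pos (hconn : G.Connected) (hdeg : BoundedDegree G)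
    (hE : E ∈ measurableCylinders (fun _ : G.edgeSet => Bool))
    (h : 0 < prob G p₀ (clusterInfinite G w)) :
    Tendsto (fun p => condProb G p E (clusterInfinite G w)) (𝓝[>] p₀)
      (𝓝 (condProb G p₀ E (clusterInfinite G w))) := by
  obtain ⟨N, -, hEN⟩ := exists_depOn_ball hE w w
  simp_rw [condProb_eq_div (measurableSet_clusterInfinite hconn hdeg w)]
  refine (tendsto_prob_inter_clusterInfinite_nhdsGT hconn hdeg hEN).div ?_ h.ne'
  simpa using tendsto_prob_inter_clusterInfinite_nhdsGT (E := Set.univ) (N := 0) (w := w)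
    (p₀ := p₀) hconn hdeg fun _ _ _ h => h

end Percolating

/-! ### Limits of cylinder probabilities form a measure -/

section LimitMeasure

variable {V : Type*} {G : SimpleGraph V}

lemma countable_edgeSet (hconn : G.Connected) (hdeg : BoundedDegree G) (v : V) :
    Countable G.edgeSet := by
  have h1 : (⋃ n, edgesIn G (ball G v n)).Countable :=
    Set.countable_iUnion fun n => (edgesIn_finite (ball_finite hconn hdeg v n)).countable
  have h2 : (⋃ n, edgesIn G (ball G v n)) = Set.univ :=
    Set.eq_univ_of_forall fun e => Set.mem_iUnion.2 (exists_mem_edgesIn_ball v e)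
  rw [h2] at h1
  exact Set.countable_univ_iff.1 h1

/-- If all cylinder probabilities converge, the limits are given by a probability measure. -/
lemma exists_limit_measure [Countable G.edgeSet] (μ : ℕ → Measure (Config G))
    (hμ : ∀ n, IsProbabilityMeasure (μ n))
    (hlim : ∀ E ∈ measurableCylinders (fun _ : G.edgeSet => Bool),
      ∃ ℓ : ℝ, Tendsto (fun n => (μ n).real E) atTop (𝓝 ℓ)) :
    ∃ ν : Measure (Config G), IsProbabilityMeasure ν ∧
      ∀ E ∈ measurableCylinders (fun _ : G.edgeSet => Bool),
        Tendsto (fun n => (μ n).real E) atTop (𝓝 (ν.real E)) := by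
  let m : ℕ → ProbabilityMeasure (Config G) := fun n => ⟨μ n, hμ n⟩
  -- Configurations form a compact space, so the laws converge along an ultrafilter. Cylinders are
  -- clopen, so their probabilities converge along it too, necessarily to the given limits.
  obtain ⟨ν, hν⟩ := exists_clusterPt_of_compactSpace (map m (hyperfilter ℕ : Filter ℕ))
  have hν' : Tendsto m (hyperfilter ℕ : Filter ℕ) (𝓝 ν) := by
    have := (Ultrafilter.clusterPt_iff (f := (hyperfilter ℕ).map m)).1 hν
    exact this
  refine ⟨ν, inferInstance, fun E hE => ?_⟩
  obtain ⟨ℓ, hℓ⟩ := hlim E hE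
  have hcl : IsClopen E := by
    obtain ⟨s, S, -, rfl⟩ := (mem_measurableCylinders E).1 hE
    exact (isClopen_discrete S).preimage (by fun_prop)
  have h1 : Tendsto (fun n => (μ n) E) (hyperfilter ℕ : Filter ℕ) (𝓝 ((ν : Measure _) E)) :=
    ProbabilityMeasure.tendsto_measure_of_null_frontier_of_tendsto' hν'
      (by simp [hcl.frontier_eq])
  have h2 : Tendsto (fun n => (μ n).real E) (hyperfilter ℕ : Filter ℕ)
      (𝓝 ((ν : Measure _).real E)) := (ENNReal.tendsto_toReal (measure_ne_top _ _)).comp h1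
  have h3 := hℓ.mono_left (Nat.hyperfilter_le_atTop)
  rw [tendsto_nhds_unique h2 h3]
  exact hℓ

end LimitMeasure

end BondPercolation

/-! ### The dichotomy at `p_c` -/

theorem theorem1 {V : Type*} [Infinite V] (G : SimpleGraph V) (hconn : G.Connected)
    (hdeg : BondPercolation.BoundedDegree G) :
    -- uniqueness at every `p`, and quasi-multiplicativity uniformly on `[p_c, p_c + δ]`
    ((∀ p : unitInterval, BondPercolation.UniqueInfiniteCluster G p) →
      (∃ v : V, ∃ δ : ℝ, 0 < δ ∧ ∃ c : ℝ, 0 < c ∧ ∀ p : unitInterval,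
        BondPercolation.pc G ≤ p → (p : ℝ) ≤ (BondPercolation.pc G : ℝ) + δ →
          BondPercolation.QuasiMultiplicative G v p c) →
      ∀ w : V, ∃ ν : MeasureTheory.Measure (BondPercolation.Config G),
        MeasureTheory.IsProbabilityMeasure ν ∧
        ∀ E ∈ MeasureTheory.measurableCylinders (fun _ : G.edgeSet => Bool),
          Filter.Tendsto
            (fun n : ℕ => BondPercolation.condProb G (BondPercolation.pc G) E
              (BondPercolation.conn G {w} (BondPercolation.sphere G w n)))
            Filter.atTop (nhds (ν.real E)) ∧
          Filter.Tendsto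
            (fun p : unitInterval => BondPercolation.condProb G p E
              (BondPercolation.clusterInfinite G w))
            (nhdsWithin (BondPercolation.pc G) (Set.Ioi (BondPercolation.pc G)))
            (nhds (ν.real E))) ∧
    -- both assumptions at `p = p_c` only
    (BondPercolation.UniqueInfiniteCluster G (BondPercolation.pc G) →
      (∃ v : V, ∃ c : ℝ, 0 < c ∧
        BondPercolation.QuasiMultiplicative G v (BondPercolation.pc G) c) →
      ∀ w : V, ∀ E ∈ MeasureTheory.measurableCylinders (fun _ : G.edgeSet => Bool),
        ∃ L : ℝ, Filter.Tendsto
          (fun n : ℕ => BondPercolation.condProb G (BondPercolation.pc G) E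
            (BondPercolation.conn G {w} (BondPercolation.sphere G w n)))
          Filter.atTop (nhds L)) := by
  have hpc := BondPercolation.pc_pos hconn hdeg
  -- By finite energy and `p_c > 0`, the absence of percolation from one vertex implies its absence
  -- from all.
  have h0 : ∀ w, BondPercolation.prob G (BondPercolation.pc G)
      (BondPercolation.clusterInfinite G w) = 0 → ∀ x, BondPercolation.prob G
        (BondPercolation.pc G) (BondPercolation.clusterInfinite G x) = 0 := by
    intro w hw x
    obtain ⟨k, hk⟩ := BondPercolation.exists_pow_mul_prob_clusterInfinite_le hconn hdeg w x
    have h1 := hk (BondPercolation.pc G)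
    rw [hw] at h1
    have h2 : (0 : ℝ) < (BondPercolation.pc G : ℝ) ^ k := pow_pos (by exact_mod_cast hpc) k
    exact le_antisymm (nonpos_of_mul_nonpos_right h1 h2) BondPercolation.prob_nonneg
  refine ⟨?_, ?_⟩
  · rintro - ⟨v, δ, hδ, c, hc, hqm⟩ w
    have hqm₀ := hqm _ le_rfl (by linarith)
    rcases (BondPercolation.prob_nonneg (G := G) (p := BondPercolation.pc G)
      (A := BondPercolation.clusterInfinite G w)).eq_or_lt with hw | hw
    · have h0' := h0 w hw.symm
      have := BondPercolation.countable_edgeSet hconn hdeg v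
      have hprob : ∀ n, MeasureTheory.IsProbabilityMeasure (ProbabilityTheory.cond
          (BondPercolation.perc G (BondPercolation.pc G))
          (BondPercolation.conn G {w} (BondPercolation.sphere G w n))) := by
        intro n
        refine ProbabilityTheory.cond_isProbabilityMeasure fun h => ?_
        have h1 := BondPercolation.prob_reach_pos (v := w) (w := w) (n := n) hconn hdeg hpc
          (by simp)
        rw [← BondPercolation.conn_sphere_eq_reach hconn, BondPercolation.prob,
          MeasureTheory.measureReal_def, h] at h1
        simp at h1
      obtain ⟨ν, hν, hlim⟩ := BondPercolation.exists_limit_measure _ hprob fun E hE =>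
        BondPercolation.exists_tendsto_condProb hconn hdeg hpc h0' hc hqm₀ hE w
      exact ⟨ν, hν, fun E hE => ⟨hlim E hE,
        BondPercolation.tendsto_condProb_clusterInfinite_nhdsGT hconn hdeg h0' hc hδ hqm hE w
          (hlim E hE)⟩⟩
    -- With percolation at `p_c`, the measure is the percolation law conditioned on an infinite
    -- cluster of `w`.
    · refine ⟨ProbabilityTheory.cond (BondPercolation.perc G (BondPercolation.pc G))
        (BondPercolation.clusterInfinite G w),
        ProbabilityTheory.cond_isProbabilityMeasure fun h => ?_, fun E hE => ⟨?_, ?_⟩⟩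
      · rw [BondPercolation.prob, MeasureTheory.measureReal_def, h] at hw
        simp at hw
      · exact BondPercolation.tendsto_condProb_conn_sphere_of_pos hconn hdeg
          (.of_mem_measurableCylinders hE) hw
      · exact BondPercolation.tendsto_condProb_clusterInfinite_of_pos hconn hdeg hE hw
  · rintro - ⟨v, c, hc, hqm₀⟩ w E hE
    rcases (BondPercolation.prob_nonneg (G := G) (p := BondPercolation.pc G)
      (A := BondPercolation.clusterInfinite G w)).eq_or_lt with hw | hw
    · exact BondPercolation.exists_tendsto_condProb hconn hdeg hpc (h0 w hw.symm) hc hqm₀ hE w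
    · exact ⟨_, BondPercolation.tendsto_condProb_conn_sphere_of_pos hconn hdeg
        (.of_mem_measurableCylinders hE) hw⟩
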